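/- Let $d\ge 2$. A literal over Boolean variables $x_1,\dots,x_n$ is a variable or its negation; a $d$-clause is a disjunction of $d$ distinct literals, a $d$-CNF formula is a finite set (conjunction) of $d$-clauses, and the weight of an assignment is the number of variables set to TRUE. For $p\in[0,1]$ let $\mathcal F(n,p;d)$ be the random $d$-CNF formula over $x_1,\dots,x_n$ obtained as follows: independently for each set $S$ of $d$ variables, with probability $p$ one includes a clause chosen uniformly at random from the $2^d-1$ clauses over $S$ (each variable of $S$ occurring exactly once) that contain at least one negated literal; with probability $1-p$ no clause over $S$ is included. There are an algorithm (a program for a random access machine with unit-cost addition, subtraction and indirect addressing) and constants $A,e\in\mathbb N$, all depending only on $d$, such that the following holds. (1) On every instance $(\mathcal F,k)$ consisting of a $d$-CNF formula $\mathcal F$ over $n\ge 1$ variables and an integer $k\ge 1$, with the clauses and their literals listed without repetitions in any order, the algorithm halts within $A\,(k^2n+n^{e})$ steps, i.e. in $O(k^2n+n^{O(1)})$ time, and either outputs an assignment of weight $k$ that satisfies $\mathcal F$, or correctly reports that no such assignment exists, or outputs FAILURE. (2) For all fixed $k\ge 1$ and $c>0$, with $p=p(n)=c\log n/n^{d-1}$,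 the probability that on the instance $(\mathcal F(n,p;d),k)$ (for every such listing of the formula) the algorithm outputs a satisfying assignment of weight $k$ or correctly reports that none exists tends to $1$ as $n\to\infty$. -/

import Mathlib

open MeasureTheory Filter Topology
open scoped ENNReal

namespace WSat

/-! ## CNF formulas -/

/-- A literal over the variables `x_0, …, x_{n-1}`: a variable together with its sign
(`true` for the positive literal, `false` for the negated one). -/
abbrev Lit (n : ℕ) := Fin n × Bool

/-- A clause: a finite set of literals, read as their disjunction. -/
abbrev Clause (n : ℕ) := Finset (Lit n)

/-- A CNF formula: a finite set of clauses, read as their conjunction. -/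
abbrev Formula (n : ℕ) := Finset (Clause n)

/-- A truth assignment. -/
abbrev Assignment (n : ℕ) := Fin n → Bool

/-- Every clause of the formula consists of exactly `d` literals. -/
def IsDCNF {n : ℕ} (d : ℕ) (F : Formula n) : Prop :=
  ∀ C ∈ F, C.card = d

/-- The assignment `α` satisfies the formula `F`. -/
def Satisfies {n : ℕ} (α : Assignment n) (F : Formula n) : Prop :=
  ∀ C ∈ F, ∃ l ∈ C, α l.1 = l.2

/-- The number of variables that are set to TRUE. -/
def weight {n : ℕ} (α : Assignment n) : ℕ :=
  (Finset.univ.filter fun x => α x = true).card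

/-! ## The random model -/

/-- The hyperedges that may occur: the sets of `d` variables. -/
abbrev DSet (n d : ℕ) := {S : Finset (Fin n) // S.card = d}

/-- What is drawn for one `d`-set of variables: `none` if it is not a hyperedge, and otherwise
`some N`, where `N` is the set of those variables that occur negated in the selected clause. -/
abbrev Draw (n : ℕ) := Option (Finset (Fin n))

instance (n : ℕ) : MeasurableSpace (Draw n) := ⊤

/-- The clause over the variables in `S` in which exactly the variables in `N` are negated. -/
def clauseOn {n : ℕ} (S N : Finset (Fin n)) : Clause n :=
  S.image fun x => (x, decide (x ∉ N))

/-- The law of the draw for one set `S` of variables, for `0 ≤ p ≤ 1`: with probability `1 - p`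
there is no clause over `S`; with probability `p` there is one, chosen uniformly at random among
the `2 ^ |S| - 1` clauses over `S` with at least one negated literal, that is, among the nonempty
sets `N ⊆ S`. -/
noncomputable def drawLaw {n : ℕ} (p : ℝ) (S : Finset (Fin n)) : Measure (Draw n) :=
  ENNReal.ofReal (1 - p) • Measure.dirac (none : Draw n) +
    ∑ N ∈ S.powerset.erase ∅,
      ENNReal.ofReal (p / (2 ^ S.card - 1)) • Measure.dirac (some N : Draw n)

/-- The outcomes of all draws, one for each `d`-set of variables. -/
abbrev Sample (n d : ℕ) := DSet n d → Draw n

/-- The law of the random instance: independent draws for the different `d`-sets. -/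
noncomputable def sampleLaw (n d : ℕ) (p : ℝ) : Measure (Sample n d) :=
  Measure.pi fun S => drawLaw p S.1

/-- The clause set (empty or a singleton) that one draw contributes. -/
def drawClauses {n : ℕ} (S : Finset (Fin n)) : Draw n → Formula n
  | none => ∅
  | some N => {clauseOn S N}

/-- The formula that consists of all selected clauses. -/
def Sample.formula {n d : ℕ} (ω : Sample n d) : Formula n :=
  Finset.univ.biUnion fun S => drawClauses S.1 (ω S)

/-! ## The machine model: a random access machine, programmed with while loops

The memory consists of infinite arrays of natural numbers; a program names finitely many of them.
Arithmetic is restricted to addition and truncated subtraction, and every evaluation of an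
elementary operation costs one unit of time. -/

/-- The memory: `M a i` is the content of cell `i` of array `a`. -/
abbrev Memory := ℕ → ℕ → ℕ

/-- Arithmetic expressions. -/
inductive AExp where
  | const (c : ℕ)
  | cell (a : ℕ) (i : AExp)
  | add (e f : AExp)
  | sub (e f : AExp)

/-- The value of an expression; `cell` is an indirect memory access. -/
def AExp.eval (M : Memory) : AExp → ℕ
  | const c => c
  | cell a i => M a (i.eval M)
  | add e f => e.eval M + f.eval M
  | sub e f => e.eval M - f.eval M

/-- The time it takes to evaluate an expression: the number of its operations. -/
def AExp.cost : AExp → ℕ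
  | const _ => 1
  | cell _ i => i.cost + 1
  | add e f => e.cost + f.cost + 1
  | sub e f => e.cost + f.cost + 1

/-- Programs. Tests are for being nonzero. -/
inductive Program where
  | skip
  | store (a : ℕ) (i e : AExp)
  | seq (P Q : Program)
  | ite (e : AExp) (P Q : Program)
  | loop (e : AExp) (P : Program)

/-- Write `v` into cell `i` of array `a`. -/
def Memory.write (M : Memory) (a i v : ℕ) : Memory :=
  Function.update M a (Function.update (M a) i v)

/-- `Exec P M t M'`: started with memory `M`, the program `P` halts after exactly `t` units of
time, with memory `M'`. -/
inductive Exec : Program → Memory → ℕ → Memory → Prop where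
  | skip (M : Memory) : Exec .skip M 1 M
  | store (a : ℕ) (i e : AExp) (M : Memory) :
      Exec (.store a i e) M (i.cost + e.cost + 1) (M.write a (i.eval M) (e.eval M))
  | seq (P Q : Program) (M M' M'' : Memory) (t t' : ℕ) :
      Exec P M t M' → Exec Q M' t' M'' → Exec (.seq P Q) M (t + t') M''
  | ite_true (e : AExp) (P Q : Program) (M M' : Memory) (t : ℕ) :
      e.eval M ≠ 0 → Exec P M t M' → Exec (.ite e P Q) M (e.cost + 1 + t) M'
  | ite_false (e : AExp) (P Q : Program) (M M' : Memory) (t : ℕ) :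
      e.eval M = 0 → Exec Q M t M' → Exec (.ite e P Q) M (e.cost + 1 + t) M'
  | loop_step (e : AExp) (P : Program) (M M' M'' : Memory) (t t' : ℕ) :
      e.eval M ≠ 0 → Exec P M t M' → Exec (.loop e P) M' t' M'' →
      Exec (.loop e P) M (e.cost + 1 + t + t') M''
  | loop_done (e : AExp) (P : Program) (M : Memory) :
      e.eval M = 0 → Exec (.loop e P) M (e.cost + 1) M

/-! ## Input and output -/

/-- A list of lists of literals that writes down the formula `F`, without repetitions, with the
clauses and the literals within each clause in an arbitrary order. -/
structure IsListing {n : ℕ} (L : List (List (Lit n))) (F : Formula n) : Prop where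
  literals_nodup : ∀ l ∈ L, l.Nodup
  clauses_nodup : (L.map List.toFinset).Nodup
  clauses_eq : (L.map List.toFinset).toFinset = F

/-- The initial memory for the instance `(L, k)`. Array `0` holds the number of variables, the
weight `k` and the number of clauses; arrays `1` and `2` hold the variables and the signs of the
literals, clause after clause. Everything else is `0`. -/
def input {n : ℕ} (L : List (List (Lit n))) (k : ℕ) : Memory
  | 0, 0 => n
  | 0, 1 => k
  | 0, 2 => L.length
  | 1, i => (L.flatten.map fun l => (l.1 : ℕ)).getD i 0
  | 2, i => (L.flatten.map fun l => l.2.toNat).getD i 0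
  | _, _ => 0

/-- Cell `0` of array `3` holds the verdict: `0` for FAILURE, `1` if an assignment has been
found, `2` if the program reports that there is none. -/
def verdict (M : Memory) : ℕ := M 3 0

/-- The assignment that the program has left in array `4`. -/
def outputAssignment (n : ℕ) (M : Memory) : Assignment n :=
  fun x => decide (M 4 x = 1)

/-- The final memory holds a correct answer for `(F, k)`: a satisfying assignment of weight `k`,
or the report that there is none, in a case where indeed there is none. -/
def Answers {n : ℕ} (F : Formula n) (k : ℕ) (M : Memory) : Prop :=
  (verdict M = 1 ∧ Satisfies (outputAssignment n M) F ∧ weight (outputAssignment n M) = k) ∨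
  (verdict M = 2 ∧ ¬ ∃ α : Assignment n, Satisfies α F ∧ weight α = k)

/-- The final memory holds the verdict FAILURE. -/
def Fails (M : Memory) : Prop := verdict M = 0

end WSat

open WSat

/-! Let `deg x` count the clauses falsified when `x` alone is true. In the random formula these are
the clauses whose only negated variable is `x`, so `deg x` has mean about λ log n with λ =
`degreeRate d c`. Two certificates decide an instance. Positive: a nonempty set of degree-zero
("isolated") variables, no two in a common clause, satisfies the formula
(`satisfies_of_subset_safe`), so `k` safe variables give a solution. Negative: in a solution of
weight `k`, the clauses counted by `deg x` for a true `x` are covered by positive occurrences of the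
other `k - 1` true variables, so one of these covers a `1/(k-1)` fraction and `x` is `Low`. If all
codegrees between low variables vanish, every true variable is isolated, which is impossible with
fewer than `k` isolated variables (`not_exists_of_refuted`). Both certificates are sound on every
input, so only the probability that neither applies matters.

If λ > 1/2, the expected number of selected sets containing two variables of degree at most `2k`
tends to 0, being n^(1-2λ) up to a factor n^o(1), and the expected number of triples of selected
sets with two common variables is O(log³ n / n). When neither occurs, codegrees are at most 2, low
variables have degree at most `2k` and lie in no common clause, so all isolated variables are safe
and one certificate applies (`Proper.decided`).

If λ ≤ 1/2, the number of isolated variables has mean n^(1-λ+o(1)) and variance at most its mean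
(`expect_sq_isolatedCount_le`), while only n^(1-2λ+o(1)) of them are expected to be unsafe.
Chebyshev and Markov leave `k` safe ones.

On the machine side, the certificates are written as terms with bounded sums, which compile to
programs of polynomial running time (`runs_compile`). The weight enters the length of a sum only
through `min n k`, so the time is polynomial in `n` for every `k`. -/

namespace WSat

/-! ## Running programs within a time bound -/

/-- `P` halts on `M` within `T` units of time, with memory `M'`. -/
def Runs (P : Program) (M : Memory) (T : ℕ) (M' : Memory) : Prop :=
  ∃ t ≤ T, Exec P M t M'

theorem Memory.write_apply (M : Memory) (a i v b j : ℕ) :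
    M.write a i v b j = if b = a ∧ j = i then v else M b j := by
  unfold Memory.write
  by_cases h : b = a
  · subst h
    by_cases h' : j = i <;> simp [h']
  · simp [h]

theorem Runs.store (a : ℕ) (i e : AExp) (M : Memory) {v w : ℕ} (hv : i.eval M = v)
    (hw : e.eval M = w) : Runs (.store a i e) M (i.cost + e.cost + 1) (M.write a v w) := by
  subst hv hw
  exact ⟨_, le_rfl, Exec.store a i e M⟩

theorem Runs.seq {P Q : Program} {M M' M'' : Memory} {T T' : ℕ} (h : Runs P M T M')
    (h' : Runs Q M' T' M'') : Runs (.seq P Q) M (T + T') M'' := by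
  obtain ⟨t, ht, h⟩ := h
  obtain ⟨t', ht', h'⟩ := h'
  exact ⟨_, by omega, Exec.seq _ _ _ _ _ _ _ h h'⟩

theorem Runs.mono {P : Program} {M M' : Memory} {T T' : ℕ} (h : Runs P M T M') (hT : T ≤ T') :
    Runs P M T' M' := by
  obtain ⟨t, ht, h⟩ := h
  exact ⟨t, ht.trans hT, h⟩

/-- A loop whose test counts down from `b` to `0`. -/
theorem Runs.loop {e : AExp} {P : Program} {Inv : ℕ → Memory → Prop} {b T : ℕ}
    (he : ∀ j ≤ b, ∀ M, Inv j M → e.eval M = b - j)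
    (hP : ∀ j < b, ∀ M, Inv j M → ∃ M', Runs P M T M' ∧ Inv (j + 1) M')
    {M : Memory} (hM : Inv 0 M) :
    ∃ M', Runs (.loop e P) M (b * (e.cost + 1 + T) + (e.cost + 1)) M' ∧ Inv b M' := by
  suffices H : ∀ r j, j + r = b → ∀ M, Inv j M →
      ∃ M', Runs (.loop e P) M (r * (e.cost + 1 + T) + (e.cost + 1)) M' ∧ Inv b M' from
    H b 0 (by omega) M hM
  intro r
  induction r with
  | zero =>
    intro j hj M hM
    obtain rfl : j = b := by omega
    exact ⟨M, ⟨_, by omega, Exec.loop_done e P M (by rw [he j le_rfl M hM]; omega)⟩, hM⟩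
  | succ r ih =>
    intro j hj M hM
    obtain ⟨M₁, ⟨t, ht, h₁⟩, hM₁⟩ := hP j (by omega) M hM
    obtain ⟨M₂, ⟨t', ht', h₂⟩, hM₂⟩ := ih (j + 1) (by omega) M₁ hM₁
    refine ⟨M₂, ⟨_, ?_, Exec.loop_step e P M M₁ M₂ t t'
      (by rw [he j (by omega) M hM]; omega) h₁ h₂⟩, hM₂⟩
    rw [Nat.succ_mul]
    omega

/-! ## Counting terms and their compilation -/

/-- Terms over the input arrays `0`, `1`, `2` with named variables and bounded sums. -/
inductive Term where
  | const (c : ℕ)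
  | var (i : ℕ)
  | inp (a : Fin 3) (q : Term)
  | add (q r : Term)
  | sub (q r : Term)
  | sum (i : ℕ) (b q : Term)

namespace Term

/-- The value of a term for the input `I` and the variable assignment `ρ`. -/
def eval (I : Memory) : Term → (ℕ → ℕ) → ℕ
  | const c, _ => c
  | var i, ρ => ρ i
  | inp a q, ρ => I a (q.eval I ρ)
  | add q r, ρ => q.eval I ρ + r.eval I ρ
  | sub q r, ρ => q.eval I ρ - r.eval I ρ
  | sum i b q, ρ => ∑ v ∈ Finset.range (b.eval I ρ), q.eval I (Function.update ρ i v)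

/-- All sums that occur in the evaluation of the term have at most `N` summands. -/
def Bounded (I : Memory) (N : ℕ) : Term → Prop
  | const _ => True
  | var _ => True
  | inp _ q => q.Bounded I N
  | add q r => q.Bounded I N ∧ r.Bounded I N
  | sub q r => q.Bounded I N ∧ r.Bounded I N
  | sum _ b q => (∀ ρ, b.eval I ρ ≤ N) ∧ b.Bounded I N ∧ q.Bounded I N

/-- The program that evaluates a term. The variables are in array `5`, and the arrays `6`, `7`, `8`
are used from cell `k` on; the value is left in cell `k` of array `6`. -/
def compile : Term → ℕ → Program
  | const c, k => .store 6 (.const k) (.const c)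
  | var i, k => .store 6 (.const k) (.cell 5 (.const i))
  | inp a q, k => .seq (q.compile k) (.store 6 (.const k) (.cell a (.cell 6 (.const k))))
  | add q r, k => .seq (q.compile k) (.seq (r.compile (k + 1))
      (.store 6 (.const k) (.add (.cell 6 (.const k)) (.cell 6 (.const (k + 1))))))
  | sub q r, k => .seq (q.compile k) (.seq (r.compile (k + 1))
      (.store 6 (.const k) (.sub (.cell 6 (.const k)) (.cell 6 (.const (k + 1))))))
  | sum i b q, k => .seq (b.compile k) (.seq (.store 8 (.const k) (.cell 6 (.const k)))
      (.seq (.store 7 (.const k) (.cell 5 (.const i))) (.seq (.store 6 (.const k) (.const 0))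
      (.seq (.store 5 (.const i) (.const 0)) (.seq
        (.loop (.sub (.cell 8 (.const k)) (.cell 5 (.const i))) (.seq (q.compile (k + 1))
          (.seq (.store 6 (.const k) (.add (.cell 6 (.const k)) (.cell 6 (.const (k + 1)))))
            (.store 5 (.const i) (.add (.cell 5 (.const i)) (.const 1))))))
        (.store 5 (.const i) (.cell 7 (.const k))))))))

/-- A time bound for the compiled program, if all sums have at most `N` summands. -/
def time (N : ℕ) : Term → ℕ
  | const _ => 3
  | var _ => 4
  | inp _ q => q.time N + 5
  | add q r => q.time N + r.time N + 7
  | sub q r => q.time N + r.time N + 7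
  | sum _ b q => b.time N + (N * (q.time N + 20) + 30)

/-- Each sum multiplies the time by about `N`, and the nesting depth is fixed with the term. `key`
merges two monomial bounds and a constant into one monomial. -/
theorem exists_time_le (q : Term) : ∃ C D : ℕ, ∀ N, q.time N ≤ C * (N + 1) ^ D := by
  have key : ∀ C D C' D' c : ℕ, ∀ N : ℕ, C * (N + 1) ^ D + C' * (N + 1) ^ D' + c
      ≤ (C + C' + c) * (N + 1) ^ (D + D') := by
    intro C D C' D' c N
    have h1 : (N + 1) ^ D ≤ (N + 1) ^ (D + D') := Nat.pow_le_pow_right (by omega) (by omega)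
    have h2 : (N + 1) ^ D' ≤ (N + 1) ^ (D + D') := Nat.pow_le_pow_right (by omega) (by omega)
    have h3 : 1 ≤ (N + 1) ^ (D + D') := Nat.one_le_pow _ _ (by omega)
    nlinarith [Nat.mul_le_mul_left C h1, Nat.mul_le_mul_left C' h2, Nat.mul_le_mul_left c h3]
  induction q with
  | const c => exact ⟨3, 0, fun N => by simp [time]⟩
  | var i => exact ⟨4, 0, fun N => by simp [time]⟩
  | inp a q ih =>
    obtain ⟨C, D, h⟩ := ih
    refine ⟨_, _, fun N => le_trans ?_ (key C D 0 0 5 N)⟩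
    have := h N
    simp only [time]
    omega
  | add q r ih ih' =>
    obtain ⟨C, D, h⟩ := ih
    obtain ⟨C', D', h'⟩ := ih'
    refine ⟨_, _, fun N => le_trans ?_ (key C D C' D' 7 N)⟩
    have := h N
    have := h' N
    simp only [time]
    omega
  | sub q r ih ih' =>
    obtain ⟨C, D, h⟩ := ih
    obtain ⟨C', D', h'⟩ := ih'
    refine ⟨_, _, fun N => le_trans ?_ (key C D C' D' 7 N)⟩
    have := h N
    have := h' N
    simp only [time]
    omega
  | sum i b q ih ih' =>
    obtain ⟨C, D, h⟩ := ih
    obtain ⟨C', D', h'⟩ := ih'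
    refine ⟨_, _, fun N => le_trans ?_ (key C D (C' + 20) (D' + 1) 30 N)⟩
    have h1 := h N
    have h2 := h' N
    have h3 : N * (q.time N + 20) ≤ (C' + 20) * (N + 1) ^ (D' + 1) := by
      have h4 : 1 ≤ (N + 1) ^ D' := Nat.one_le_pow _ _ (by omega)
      calc N * (q.time N + 20) ≤ (N + 1) * (C' * (N + 1) ^ D' + 20 * (N + 1) ^ D') :=
            Nat.mul_le_mul (by omega) (by omega)
        _ = (C' + 20) * (N + 1) ^ (D' + 1) := by ring
    simp only [time]
    omega

/-- The compiled program computes the value of the term within the time bound, and changes only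
cells from `k` on in the arrays from `6` on. -/
theorem runs_compile {I : Memory} {N : ℕ} (q : Term) : q.Bounded I N → ∀ (k : ℕ) (M : Memory),
    (∀ a < 3, M a = I a) → ∃ M', Runs (q.compile k) M (q.time N) M' ∧
      M' 6 k = q.eval I (M 5) ∧ ∀ a i, a < 6 ∨ i < k → M' a i = M a i := by
  induction q with
  | const c =>
    intro _ k M hM
    refine ⟨_, Runs.store 6 _ _ M rfl rfl, ?_, ?_⟩
    · simp [Memory.write_apply, AExp.eval, eval]
    · intro a i h
      simp only [Memory.write_apply, AExp.eval]
      rw [if_neg (by omega)]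
  | var i =>
    intro _ k M hM
    refine ⟨_, Runs.store 6 _ _ M rfl rfl, ?_, ?_⟩
    · simp [Memory.write_apply, AExp.eval, eval]
    · intro a i h
      simp only [Memory.write_apply, AExp.eval]
      rw [if_neg (by omega)]
  | inp a q ih =>
    intro hb k M hM
    obtain ⟨M₁, h₁, hv₁, hf₁⟩ := ih hb k M hM
    refine ⟨_, (h₁.seq (Runs.store 6 _ _ M₁ rfl rfl)).mono ?_, ?_, ?_⟩
    · simp [time, AExp.cost]
    · have : M₁ a (q.eval I (M 5)) = I a (q.eval I (M 5)) := by
        rw [hf₁ _ _ (Or.inl (by omega)), hM _ a.2]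
      simp [Memory.write_apply, AExp.eval, eval, hv₁, this]
    · intro b i h
      simp only [Memory.write_apply, AExp.eval]
      rw [if_neg (by omega), hf₁ _ _ h]
  | add q r ih ih' =>
    intro hb k M hM
    obtain ⟨M₁, h₁, hv₁, hf₁⟩ := ih hb.1 k M hM
    -- Evaluating `r` from cell `k + 1` on preserves the value of `q` in cell `k`.
    obtain ⟨M₂, h₂, hv₂, hf₂⟩ := ih' hb.2 (k + 1) M₁ (fun a ha => by
      rw [← hM a ha]; exact funext fun i => hf₁ a i (Or.inl (by omega)))
    have h5 : M₁ 5 = M 5 := funext fun i => hf₁ 5 i (Or.inl (by omega))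
    refine ⟨_, (h₁.seq (h₂.seq (Runs.store 6 _ _ M₂ rfl rfl))).mono ?_, ?_, ?_⟩
    · simp [time, AExp.cost]
      omega
    · simp [Memory.write_apply, AExp.eval, eval, hv₂, hf₂ 6 k (Or.inr (by omega)), hv₁, h5]
    · intro a i h
      simp only [Memory.write_apply, AExp.eval]
      rw [if_neg (by omega), hf₂ _ _ (by omega), hf₁ _ _ h]
  | sub q r ih ih' =>
    intro hb k M hM
    obtain ⟨M₁, h₁, hv₁, hf₁⟩ := ih hb.1 k M hM
    obtain ⟨M₂, h₂, hv₂, hf₂⟩ := ih' hb.2 (k + 1) M₁ (fun a ha => by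
      rw [← hM a ha]; exact funext fun i => hf₁ a i (Or.inl (by omega)))
    have h5 : M₁ 5 = M 5 := funext fun i => hf₁ 5 i (Or.inl (by omega))
    refine ⟨_, (h₁.seq (h₂.seq (Runs.store 6 _ _ M₂ rfl rfl))).mono ?_, ?_, ?_⟩
    · simp [time, AExp.cost]
      omega
    · simp [Memory.write_apply, AExp.eval, eval, hv₂, hf₂ 6 k (Or.inr (by omega)), hv₁, h5]
    · intro a i h
      simp only [Memory.write_apply, AExp.eval]
      rw [if_neg (by omega), hf₂ _ _ (by omega), hf₁ _ _ h]
  | sum i b q ih ih' =>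
    intro hb k M hM
    obtain ⟨M₁, h₁, hv₁, hf₁⟩ := ih hb.2.1 k M hM
    set B := b.eval I (M 5) with hB
    -- Cell `i` of array `5` is both loop counter and summation variable. It is the only cell
    -- excepted from the frame; its old value waits in array `7` to be restored.
    let Inv : ℕ → Memory → Prop := fun j R =>
      (∀ a x, a < 6 ∨ x < k → (a ≠ 5 ∨ x ≠ i) → R a x = M a x) ∧ R 5 i = j ∧ R 8 k = B ∧
      R 7 k = M 5 i ∧ R 6 k = ∑ v ∈ Finset.range j, q.eval I (Function.update (M 5) i v)
    have hbody : ∀ j < B, ∀ R, Inv j R → ∃ R', Runs (.seq (q.compile (k + 1))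
          (.seq (.store 6 (.const k) (.add (.cell 6 (.const k)) (.cell 6 (.const (k + 1)))))
            (.store 5 (.const i) (.add (.cell 5 (.const i)) (.const 1))))) R
          (q.time N + 13) R' ∧ Inv (j + 1) R' := by
      rintro j - R ⟨hR, hR5, hR8, hR7, hR6⟩
      obtain ⟨R₁, g₁, gv₁, gf₁⟩ := ih' hb.2.2 (k + 1) R (fun a ha => by
        rw [← hM a ha]; exact funext fun x => hR a x (Or.inl (by omega)) (Or.inl (by omega)))
      have hρ : R 5 = Function.update (M 5) i j := by
        funext x
        by_cases hx : x = i
        · subst hx; simp [hR5]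
        · simp [hx, hR 5 x (Or.inl (by omega)) (Or.inr hx)]
      refine ⟨_, (g₁.seq ((Runs.store 6 _ _ R₁ rfl rfl).seq
        (Runs.store 5 _ _ _ rfl rfl))).mono ?_, ?_, ?_, ?_, ?_, ?_⟩
      · simp [AExp.cost]
      · intro a x h h'
        simp only [Memory.write_apply, AExp.eval]
        rw [if_neg (by omega), if_neg (by omega), gf₁ _ _ (by omega), hR _ _ h h']
      · simp [Memory.write_apply, AExp.eval, gf₁ 5 i (Or.inl (by omega)), hR5]
      · simp [Memory.write_apply, gf₁ 8 k (Or.inr (by omega)), hR8]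
      · simp [Memory.write_apply, gf₁ 7 k (Or.inr (by omega)), hR7]
      · simp [Memory.write_apply, AExp.eval, gf₁ 6 k (Or.inr (by omega)), hR6, gv₁, hρ,
          Finset.sum_range_succ]
    have htest : ∀ j ≤ B, ∀ R, Inv j R →
        (AExp.sub (.cell 8 (.const k)) (.cell 5 (.const i))).eval R = B - j := by
      rintro j - R ⟨-, hR5, hR8, -, -⟩
      simp [AExp.eval, hR5, hR8]
    let M₂ := (M₁.write 8 k B).write 7 k (M 5 i)
    let M₄ := (M₂.write 6 k 0).write 5 i 0
    have e₁ : Runs (.store 8 (.const k) (.cell 6 (.const k))) M₁ 4 (M₁.write 8 k B) :=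
      Runs.store _ _ _ _ rfl hv₁
    have e₂ : Runs (.store 7 (.const k) (.cell 5 (.const i))) (M₁.write 8 k B) 4 M₂ :=
      Runs.store _ _ _ _ rfl (by
        simp [AExp.eval, Memory.write_apply, hf₁ 5 i (Or.inl (by omega))])
    have e₃ : Runs (.store 6 (.const k) (.const 0)) M₂ 3 (M₂.write 6 k 0) :=
      Runs.store _ _ _ _ rfl rfl
    have e₄ : Runs (.store 5 (.const i) (.const 0)) (M₂.write 6 k 0) 3 M₄ :=
      Runs.store _ _ _ _ rfl rfl
    have hI : Inv 0 M₄ := by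
      refine ⟨?_, ?_, ?_, ?_, ?_⟩
      · intro a x h h'
        simp only [M₄, M₂, Memory.write_apply]
        rw [if_neg (by omega), if_neg (by omega), if_neg (by omega), if_neg (by omega), hf₁ _ _ h]
      all_goals simp [M₄, M₂, Memory.write_apply]
    obtain ⟨R, hR, hR0, -, -, hR7, hR6⟩ := Runs.loop htest hbody hI
    have e₅ : Runs (.store 5 (.const i) (.cell 7 (.const k))) R 4 (R.write 5 i (M 5 i)) :=
      Runs.store _ _ _ _ rfl hR7
    refine ⟨_, (h₁.seq (e₁.seq (e₂.seq (e₃.seq (e₄.seq (hR.seq e₅)))))).mono ?_, ?_, ?_⟩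
    · have hBN : B * (q.time N + 19) ≤ N * (q.time N + 19) := Nat.mul_le_mul_right _ (hb.1 _)
      have : N * (q.time N + 20) = N * (q.time N + 19) + N := by ring
      simp only [time, AExp.cost]
      ring_nf at hBN this ⊢
      omega
    · simp [Memory.write_apply, eval, hR6, hB]
    · intro a x h
      rw [Memory.write_apply]
      split_ifs with h'
      · rw [h'.1, h'.2]
      · exact hR0 a x h (by omega)

end Term

end WSat
namespace WSat

/-! ## The combinatorial quantities that the algorithm computes -/

section Quantities

variable {n : ℕ}

/-- The clause is falsified by the assignment under which only `x` is true. -/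
def Falsified (x : Fin n) (C : Clause n) : Prop :=
  ∀ l ∈ C, decide (l.1 = x) ≠ l.2

instance (x : Fin n) : DecidablePred (Falsified x) := fun C =>
  inferInstanceAs (Decidable (∀ l ∈ C, decide (l.1 = x) ≠ l.2))

/-- The variable `x` occurs in the clause. -/
def Occurs (x : Fin n) (C : Clause n) : Prop :=
  ∃ l ∈ C, l.1 = x

instance (x : Fin n) : DecidablePred (Occurs x) := fun C =>
  inferInstanceAs (Decidable (∃ l ∈ C, l.1 = x))

/-- The number of clauses that are falsified if only `x` is true. -/
def deg (F : Formula n) (x : Fin n) : ℕ :=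
  (F.filter (Falsified x)).card

/-- The number of clauses counted by `deg F x` that contain `y` positively. -/
def codeg (F : Formula n) (x y : Fin n) : ℕ :=
  (F.filter fun C => Falsified x C ∧ (y, true) ∈ C).card

/-- The variables that on their own satisfy the formula. -/
def isolated (F : Formula n) : Finset (Fin n) :=
  Finset.univ.filter fun x => deg F x = 0

/-- The isolated variables that share no clause with another isolated variable. -/
def safe (F : Formula n) : Finset (Fin n) :=
  (isolated F).filter fun x =>
    ∀ y ∈ isolated F, x ≠ y → ∀ C ∈ F, Occurs x C → ¬ Occurs y C

/-- A necessary condition for `x` to be true in a satisfying assignment of weight `k`. -/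
def Low (F : Formula n) (k : ℕ) (x : Fin n) : Prop :=
  ∃ y, deg F x ≤ (min n k - 1) * codeg F x y

instance (F : Formula n) (k : ℕ) : DecidablePred (Low F k) := fun x =>
  inferInstanceAs (Decidable (∃ y, deg F x ≤ (min n k - 1) * codeg F x y))

/-- The condition under which the algorithm reports that there is no solution. -/
def Refuted (F : Formula n) (k : ℕ) : Prop :=
  (isolated F).card < k ∧ ∀ x y, Low F k x → Low F k y → codeg F x y = 0

instance (F : Formula n) (k : ℕ) : Decidable (Refuted F k) :=
  inferInstanceAs (Decidable (_ ∧ _))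

/-- The set of the first `k` elements of `s`. -/
def firstElements (s : Finset (Fin n)) (k : ℕ) : Finset (Fin n) :=
  s.filter fun x => (s.filter (· < x)).card < k

/-- Adding a new maximum changes no earlier rank, and its own rank is the size of the old set. -/
theorem card_firstElements (s : Finset (Fin n)) (k : ℕ) :
    (firstElements s k).card = min k s.card := by
  induction s using Finset.induction_on_max with
  | empty => simp [firstElements]
  | insert a s h ih =>
    have ha : a ∉ s := fun ha => lt_irrefl _ (h a ha)
    have h1 : ∀ x ∈ s, (insert a s).filter (· < x) = s.filter (· < x) := by
      intro x hx
      rw [Finset.filter_insert, if_neg (not_lt.2 (h x hx).le)]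
    have h2 : (insert a s).filter (· < a) = s := by
      rw [Finset.filter_insert, if_neg (lt_irrefl a), Finset.filter_true_of_mem h]
    have h3 : s.filter (fun x => ((insert a s).filter (· < x)).card < k) = firstElements s k :=
      Finset.filter_congr fun x hx => by rw [h1 x hx]
    rw [firstElements, Finset.filter_insert, h2, h3]
    have h4 : a ∉ firstElements s k := fun h => ha (Finset.mem_filter.1 h).1
    split_ifs with hk
    · rw [Finset.card_insert_of_notMem h4,
        Finset.card_insert_of_notMem ha, ih]
      omega
    · rw [Finset.card_insert_of_notMem ha, ih]
      omega

/-- A clause containing `x` positively is satisfied by `x` alone. Hence `Low` and `Refuted` need not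
exclude equal variables. -/
theorem codeg_self (F : Formula n) (x : Fin n) : codeg F x x = 0 := by
  rw [codeg, Finset.card_eq_zero, Finset.filter_eq_empty_iff]
  rintro C - ⟨h, h'⟩
  simpa using h _ h'

/-- A clause meets `T` in at most one variable. It therefore sees the same values as if only that
variable were true or, if it misses `T`, as if any one chosen element of `T` were. Isolated
variables falsify nothing on their own. -/
theorem satisfies_of_subset_safe {F : Formula n} {T : Finset (Fin n)} (hT : T ⊆ safe F)
    (hne : T.Nonempty) : Satisfies (fun x => decide (x ∈ T)) F := by
  intro C hC
  by_contra! hfalse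
  have iso : ∀ x ∈ T, x ∈ isolated F := fun x hx => (Finset.mem_filter.1 (hT hx)).1
  have not_falsified : ∀ x ∈ T, ¬ Falsified x C := by
    intro x hx hf
    have h := (Finset.mem_filter.1 (iso x hx)).2
    rw [deg, Finset.card_eq_zero, Finset.filter_eq_empty_iff] at h
    exact h hC hf
  by_cases h : ∃ x ∈ T, Occurs x C
  · obtain ⟨x, hx, hxC⟩ := h
    refine not_falsified x hx fun l hl => ?_
    have hl' := hfalse l hl
    by_cases hlx : l.1 = x
    · simpa [hlx, hx] using hl'
    · have : l.1 ∉ T := fun hlT =>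
        (Finset.mem_filter.1 (hT hx)).2 l.1 (iso _ hlT) (Ne.symm hlx) C hC hxC ⟨l, hl, rfl⟩
      simpa [hlx, this] using hl'
  · push Not at h
    obtain ⟨x, hx⟩ := hne
    refine not_falsified x hx fun l hl => ?_
    have hlT : l.1 ∉ T := fun hlT => h _ hlT ⟨l, hl, rfl⟩
    have hlx : l.1 ≠ x := fun e => hlT (e ▸ hx)
    simpa [hlx, hlT] using hfalse l hl

/-- In a satisfying assignment of weight `k`, the clauses falsified by `x` alone are covered by
the remaining true variables, one of which covers a `(k - 1)`-th part of them. -/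
theorem exists_deg_le_of_satisfies {F : Formula n} {α : Assignment n} (hα : Satisfies α F)
    {x : Fin n} (hx : α x = true) (hdeg : deg F x ≠ 0) :
    ∃ y, α y = true ∧ deg F x ≤ (weight α - 1) * codeg F x y := by
  set T := Finset.univ.filter fun y => α y = true with hT
  have hxT : x ∈ T := by simp [hT, hx]
  have hcover : F.filter (Falsified x) ⊆
      (T.erase x).biUnion fun y => F.filter fun C => Falsified x C ∧ (y, true) ∈ C := by
    intro C hC
    obtain ⟨hCF, hfx⟩ := Finset.mem_filter.1 hC
    obtain ⟨⟨y, b⟩, hl, hy⟩ := hα C hCF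
    have hne := hfx _ hl
    have hb : b = true := by
      by_contra hb
      have hb : b = false := by simpa using hb
      have : y ≠ x := by
        rintro rfl
        simp only at hy
        simp [hx, hb] at hy
      subst hb
      simp [this] at hne
    subst hb
    have hyx : y ≠ x := by simpa using hne
    simp only [Finset.mem_biUnion, Finset.mem_erase, Finset.mem_filter]
    exact ⟨y, ⟨hyx, by simpa [hT] using hy⟩, hCF, hfx, hl⟩
  have hcard : deg F x ≤ ∑ y ∈ T.erase x, codeg F x y :=
    (Finset.card_le_card hcover).trans Finset.card_biUnion_le
  have hw : weight α - 1 = (T.erase x).card := by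
    rw [Finset.card_erase_of_mem hxT]
    rfl
  by_contra! hno
  have hne : (T.erase x).Nonempty := by
    by_contra h
    rw [Finset.not_nonempty_iff_eq_empty] at h
    simp [h] at hcard
    exact hdeg hcard
  -- Averaging: if every `y` covered less than its share, the whole cover would be too small.
  have h1 : ∑ y ∈ T.erase x, (T.erase x).card * codeg F x y <
      ∑ y ∈ T.erase x, deg F x := by
    refine Finset.sum_lt_sum_of_nonempty hne fun y hy => ?_
    rw [← hw]
    exact hno y (by simpa [hT] using Finset.mem_of_mem_erase hy)
  rw [← Finset.mul_sum, Finset.sum_const, smul_eq_mul] at h1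
  exact absurd (Nat.mul_le_mul_left _ hcard) (not_le.2 h1)

theorem not_exists_of_refuted {F : Formula n} {k : ℕ} (h : Refuted F k) :
    ¬ ∃ α : Assignment n, Satisfies α F ∧ weight α = k := by
  rintro ⟨α, hα, rfl⟩
  -- Truncating the weight at `n` in `Low` loses nothing.
  have hn : min n (weight α) = weight α := by
    refine min_eq_right ?_
    exact (Finset.card_filter_le _ _).trans (by simp)
  have hlow : ∀ x, α x = true → Low F (weight α) x := by
    intro x hx
    by_cases hd : deg F x = 0
    · exact ⟨x, by simp [hd]⟩
    · obtain ⟨y, -, hy⟩ := exists_deg_le_of_satisfies hα hx hd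
      exact ⟨y, by rwa [hn]⟩
  have hiso : ∀ x, α x = true → deg F x = 0 := by
    intro x hx
    by_contra hd
    obtain ⟨y, hy, hxy⟩ := exists_deg_le_of_satisfies hα hx hd
    rw [h.2 x y (hlow x hx) (hlow y hy)] at hxy
    omega
  refine absurd h.1 (not_lt.2 (Finset.card_le_card fun x hx => ?_))
  simpa [isolated] using hiso x (by simpa using hx)

end Quantities

/-! ## Reading the instance -/

namespace Term

/-- A term is read as true when it is nonzero; truncated subtraction then supplies negation and
comparison. -/
def neg (q : Term) : Term := sub (const 1) q
def conj (q r : Term) : Term := neg (add (neg q) (neg r))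
def le (q r : Term) : Term := neg (sub q r)
def eq (q r : Term) : Term := neg (add (sub q r) (sub r q))

section

variable (I : Memory) (ρ : ℕ → ℕ) (q r : Term) (N : ℕ)

theorem eval_neg : (neg q).eval I ρ = if q.eval I ρ = 0 then 1 else 0 := by
  simp only [neg, eval]
  split_ifs <;> omega

theorem eval_conj :
    (conj q r).eval I ρ = if q.eval I ρ ≠ 0 ∧ r.eval I ρ ≠ 0 then 1 else 0 := by
  simp only [conj, neg, eval]
  split_ifs <;> omega

theorem eval_le : (le q r).eval I ρ = if q.eval I ρ ≤ r.eval I ρ then 1 else 0 := by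
  simp only [le, neg, eval]
  split_ifs <;> omega

theorem eval_eq : (eq q r).eval I ρ = if q.eval I ρ = r.eval I ρ then 1 else 0 := by
  simp only [eq, neg, eval]
  split_ifs <;> omega

theorem bounded_neg : (neg q).Bounded I N ↔ q.Bounded I N := by simp [neg, Bounded]

theorem bounded_conj : (conj q r).Bounded I N ↔ q.Bounded I N ∧ r.Bounded I N := by
  simp [conj, neg, Bounded]

theorem bounded_le : (le q r).Bounded I N ↔ q.Bounded I N ∧ r.Bounded I N := by
  simp [le, neg, Bounded]

theorem bounded_eq : (eq q r).Bounded I N ↔ q.Bounded I N ∧ r.Bounded I N := by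
  simp only [eq, neg, Bounded]
  tauto

end

/-- The number of variables, the weight and the number of clauses. -/
def numVars : Term := inp 0 (const 0)
def wt : Term := inp 0 (const 1)
def numClauses : Term := inp 0 (const 2)

/-- The position of literal number `var 4` of clause number `var 3`. -/
def litPos (d : ℕ) : Term := add (sum 5 (const d) (var 3)) (var 4)
-- The offset `d * var 3` in `litPos` is a sum of `d` copies, multiplication not being an operation.
-- It is the right offset because all clauses have exactly `d` literals.
def litVar (d : ℕ) : Term := inp 1 (litPos d)
def litSign (d : ℕ) : Term := inp 2 (litPos d)

/-- The names 3, 4, 5 are bound for clause, literal and offset, so arguments must be names below 3,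
and below 2 in `safe` and `low`, which also bind 2. -/
def falsified (d x : ℕ) : Term :=
  neg (sum 4 (const d) (eq (eq (litVar d) (var x)) (litSign d)))

def occursPos (d x : ℕ) : Term := sum 4 (const d) (conj (eq (litVar d) (var x)) (litSign d))

def occurs (d x : ℕ) : Term := sum 4 (const d) (eq (litVar d) (var x))

def deg (d x : ℕ) : Term := sum 3 numClauses (falsified d x)

def codeg (d x y : ℕ) : Term := sum 3 numClauses (conj (falsified d x) (occursPos d y))

def isolated (d x : ℕ) : Term := neg (deg d x)

def cooccur (d x y : ℕ) : Term := sum 3 numClauses (conj (occurs d x) (occurs d y))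

def safe (d x : ℕ) : Term :=
  conj (isolated d x)
    (neg (sum 2 numVars (conj (neg (eq (var x) (var 2))) (conj (isolated d 2) (cooccur d x 2)))))

/-- `n - (n - k)` is `min n k`, so the sum that replaces the product has at most `n` terms however
large `k` is. -/
def low (d x : ℕ) : Term :=
  sum 2 numVars (le (deg d x)
    (sum 6 (sub (sub numVars (sub numVars wt)) (const 1)) (codeg d x 2)))

def numIsolated (d : ℕ) : Term := sum 0 numVars (isolated d 0)

def numSafe (d : ℕ) : Term := sum 0 numVars (safe d 0)

def obstructions (d : ℕ) : Term :=
  sum 0 numVars (sum 1 numVars (conj (low d 0) (conj (low d 1) (codeg d 0 1))))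

/-- The first factor makes the two outcomes exclusive, which keeps the value of `verdict` among 0,
1, 2. -/
def refuted (d : ℕ) : Term :=
  conj (neg (le wt (numSafe d))) (conj (neg (le wt (numIsolated d))) (neg (obstructions d)))

/-- `1` if there are enough safe variables, `2` if the instance is refuted, and `0` otherwise. -/
def verdict (d : ℕ) : Term := add (le wt (numSafe d)) (add (refuted d) (refuted d))

/-- `1` if variable `var 0` is among the first safe ones, as many as the weight demands. -/
def output (d : ℕ) : Term :=
  conj (safe d 0) (neg (le wt (sum 1 numVars (conj (neg (le (var 0) (var 1))) (safe d 1)))))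

theorem bounded_verdict {I : Memory} {d N : ℕ} (hn : I 0 0 ≤ N) (hm : I 0 2 ≤ N) (hd : d ≤ N) :
    (verdict d).Bounded I N := by
  have h : I 0 0 - (I 0 0 - I 0 1) - 1 ≤ N := by omega
  simp [verdict, refuted, obstructions, numSafe, numIsolated, low, safe, cooccur, isolated, codeg,
    deg, occurs, occursPos, falsified, litSign, litVar, litPos, numClauses, wt, numVars,
    bounded_neg, bounded_conj, bounded_le, bounded_eq, Bounded, eval, hn, hm, hd, h]

theorem bounded_output {I : Memory} {d N : ℕ} (hn : I 0 0 ≤ N) (hm : I 0 2 ≤ N) (hd : d ≤ N) :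
    (output d).Bounded I N := by
  simp [output, safe, cooccur, isolated,
    deg, occurs, falsified, litSign, litVar, litPos, numClauses, wt, numVars,
    bounded_neg, bounded_conj, bounded_le, bounded_eq, Bounded, eval, hn, hm, hd]

end Term

/-! ### Values of the terms on a listed formula -/

theorem getElem?_flatten {α : Type*} {d : ℕ} {L : List (List α)} (hL : ∀ l ∈ L, l.length = d)
    (j t : ℕ) (ht : t < d) : L.flatten[d * j + t]? = L[j]?.bind (·[t]?) := by
  induction L generalizing j with
  | nil => simp
  | cons l L ih =>
    have hl : l.length = d := hL l (by simp)
    cases j with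
    | zero => simp [List.getElem?_append_left (hl ▸ ht : t < l.length)]
    | succ j =>
      rw [List.flatten_cons, List.getElem?_append_right (by rw [hl, Nat.mul_succ]; omega), hl,
        show d * (j + 1) + t - d = d * j + t by rw [Nat.mul_succ]; omega,
        ih fun l hl => hL l (by simp [hl])]
      simp

theorem sum_range_length {α : Type*} (L : List α) (f : ℕ → ℕ) (g : α → ℕ)
    (h : ∀ j (hj : j < L.length), f j = g L[j]) :
    ∑ j ∈ Finset.range L.length, f j = (L.map g).sum := by
  induction L generalizing f with
  | nil => simp
  | cons a L ih =>
    rw [List.length_cons, Finset.sum_range_succ', List.map_cons, List.sum_cons, add_comm,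
      ih (fun j => f (j + 1)) fun j hj => h (j + 1) (by simpa using hj)]
    congr 1
    exact h 0 (by simp)

namespace IsListing

variable {n d k : ℕ} {F : Formula n} {L : List (List (Lit n))}

theorem length_eq (hL : IsListing L F) : L.length = F.card := by
  rw [← hL.clauses_eq, List.toFinset_card_of_nodup hL.clauses_nodup, List.length_map]

theorem literals_length (hL : IsListing L F) (hF : IsDCNF d F) : ∀ l ∈ L, l.length = d := by
  intro l hl
  rw [← List.toFinset_card_of_nodup (hL.literals_nodup l hl)]
  refine hF _ ?_
  rw [← hL.clauses_eq]
  exact List.mem_toFinset.2 (List.mem_map_of_mem hl)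

/-- Without repetitions, a sum over positions is a sum over clauses, so the order of the listing is
irrelevant. -/
theorem sum_clauses (hL : IsListing L F) (f : ℕ → ℕ) (g : Clause n → ℕ)
    (h : ∀ j (hj : j < L.length), f j = g L[j].toFinset) :
    ∑ j ∈ Finset.range L.length, f j = ∑ C ∈ F, g C := by
  rw [sum_range_length L f (fun l => g l.toFinset) h, ← hL.clauses_eq,
    List.sum_toFinset _ hL.clauses_nodup, List.map_map]
  rfl

theorem sum_literals (hL : IsListing L F) (hF : IsDCNF d F) {j : ℕ} (hj : j < L.length)
    (f : ℕ → ℕ) (g : Lit n → ℕ) (h : ∀ t (ht : t < L[j].length), f t = g L[j][t]) :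
    ∑ t ∈ Finset.range d, f t = ∑ l ∈ L[j].toFinset, g l := by
  rw [List.sum_toFinset _ (hL.literals_nodup _ (List.getElem_mem hj)),
    ← hL.literals_length hF _ (List.getElem_mem hj)]
  exact sum_range_length _ f g h

theorem eval_litVar (hL : IsListing L F) (hF : IsDCNF d F) {ρ : ℕ → ℕ} {j t : ℕ}
    (hj : j < L.length) (ht : t < L[j].length) (h3 : ρ 3 = j) (h4 : ρ 4 = t) :
    (Term.litVar d).eval (input L k) ρ = L[j][t].1 := by
  have htd : t < d := by rwa [hL.literals_length hF _ (List.getElem_mem hj)] at ht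
  simp [Term.litVar, Term.litPos, Term.eval, h3, h4, input,
    List.getD_eq_getElem?_getD, -List.map_flatten,
    getElem?_flatten (hL.literals_length hF) j t htd, hj, ht]

theorem eval_litSign (hL : IsListing L F) (hF : IsDCNF d F) {ρ : ℕ → ℕ} {j t : ℕ}
    (hj : j < L.length) (ht : t < L[j].length) (h3 : ρ 3 = j) (h4 : ρ 4 = t) :
    (Term.litSign d).eval (input L k) ρ = L[j][t].2.toNat := by
  have htd : t < d := by rwa [hL.literals_length hF _ (List.getElem_mem hj)] at ht
  simp [Term.litSign, Term.litPos, Term.eval, h3, h4, input,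
    List.getD_eq_getElem?_getD, -List.map_flatten,
    getElem?_flatten (hL.literals_length hF) j t htd, hj, ht]

theorem eval_falsified (hL : IsListing L F) (hF : IsDCNF d F) {ρ : ℕ → ℕ} {j x : ℕ} {u : Fin n}
    (hj : j < L.length) (h3 : ρ 3 = j) (hx : x < 3) (hu : ρ x = u) :
    (Term.falsified d x).eval (input L k) ρ = if Falsified u L[j].toFinset then 1 else 0 := by
  rw [Term.falsified, Term.eval_neg, Term.eval, Term.eval,
    hL.sum_literals hF hj _ fun l => if decide (l.1 = u) = l.2 then 1 else 0]
  · refine if_congr ?_ rfl rfl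
    rw [Finset.sum_eq_zero_iff]
    simp [Falsified]
  · intro t ht
    rw [Term.eval_eq, Term.eval_eq, hL.eval_litVar hF hj ht (by simp [h3]) (by simp),
      hL.eval_litSign hF hj ht (by simp [h3]) (by simp), Term.eval,
      Function.update_of_ne (by omega), hu]
    refine if_congr ?_ rfl rfl
    simp only [← Fin.ext_iff]
    by_cases h : L[j][t].1 = u <;> cases L[j][t].2 <;> simp [h]

theorem eval_occursPos (hL : IsListing L F) (hF : IsDCNF d F) {ρ : ℕ → ℕ} {j x : ℕ} {u : Fin n}
    (hj : j < L.length) (h3 : ρ 3 = j) (hx : x < 3) (hu : ρ x = u) :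
    (Term.occursPos d x).eval (input L k) ρ ≠ 0 ↔ (u, true) ∈ L[j].toFinset := by
  rw [Term.occursPos, Term.eval, Term.eval,
    hL.sum_literals hF hj _ fun l => if l = (u, true) then 1 else 0]
  · simp
  · intro t ht
    rw [Term.eval_conj, Term.eval_eq, hL.eval_litVar hF hj ht (by simp [h3]) (by simp),
      hL.eval_litSign hF hj ht (by simp [h3]) (by simp), Term.eval,
      Function.update_of_ne (by omega), hu]
    refine if_congr ?_ rfl rfl
    simp only [← Fin.ext_iff, Prod.ext_iff]
    by_cases h : L[j][t].1 = u <;> cases L[j][t].2 <;> simp [h]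

theorem eval_occurs (hL : IsListing L F) (hF : IsDCNF d F) {ρ : ℕ → ℕ} {j x : ℕ} {u : Fin n}
    (hj : j < L.length) (h3 : ρ 3 = j) (hx : x < 3) (hu : ρ x = u) :
    (Term.occurs d x).eval (input L k) ρ ≠ 0 ↔ Occurs u L[j].toFinset := by
  rw [Term.occurs, Term.eval, Term.eval,
    hL.sum_literals hF hj _ fun l => if l.1 = u then 1 else 0]
  · rw [Ne, Finset.sum_eq_zero_iff]
    simp only [Occurs, ite_eq_right_iff, one_ne_zero, imp_false, not_forall, not_not, exists_prop]
  · intro t ht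
    rw [Term.eval_eq, hL.eval_litVar hF hj ht (by simp [h3]) (by simp), Term.eval,
      Function.update_of_ne (by omega), hu]
    exact if_congr Fin.ext_iff.symm rfl rfl

theorem eval_deg (hL : IsListing L F) (hF : IsDCNF d F) {ρ : ℕ → ℕ} {x : ℕ} {u : Fin n}
    (hx : x < 3) (hu : ρ x = u) : (Term.deg d x).eval (input L k) ρ = deg F u := by
  rw [Term.deg, Term.eval, deg, Finset.card_filter]
  refine hL.sum_clauses _ _ fun j hj => ?_
  exact hL.eval_falsified hF hj (by simp) hx (by rw [Function.update_of_ne (by omega), hu])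

theorem eval_codeg (hL : IsListing L F) (hF : IsDCNF d F) {ρ : ℕ → ℕ} {x y : ℕ} {u v : Fin n}
    (hx : x < 3) (hu : ρ x = u) (hy : y < 3) (hv : ρ y = v) :
    (Term.codeg d x y).eval (input L k) ρ = codeg F u v := by
  rw [Term.codeg, Term.eval, codeg, Finset.card_filter]
  refine hL.sum_clauses _ _ fun j hj => ?_
  rw [Term.eval_conj, hL.eval_falsified hF hj (by simp) hx
    (by rw [Function.update_of_ne (by omega), hu])]
  refine if_congr (and_congr (by simp) ?_) rfl rfl
  exact hL.eval_occursPos hF hj (by simp) hy (by rw [Function.update_of_ne (by omega), hv])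

theorem eval_cooccur (hL : IsListing L F) (hF : IsDCNF d F) {ρ : ℕ → ℕ} {x y : ℕ} {u v : Fin n}
    (hx : x < 3) (hu : ρ x = u) (hy : y < 3) (hv : ρ y = v) :
    (Term.cooccur d x y).eval (input L k) ρ ≠ 0 ↔ ∃ C ∈ F, Occurs u C ∧ Occurs v C := by
  rw [Term.cooccur, Term.eval, show (Term.numClauses.eval (input L k) ρ) = L.length from rfl,
    hL.sum_clauses _ (fun C => if Occurs u C ∧ Occurs v C then 1 else 0)]
  · rw [Ne, Finset.sum_eq_zero_iff]
    simp
  · intro j hj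
    rw [Term.eval_conj]
    refine if_congr (and_congr ?_ ?_) rfl rfl
    · exact hL.eval_occurs hF hj (by simp) hx (by rw [Function.update_of_ne (by omega), hu])
    · exact hL.eval_occurs hF hj (by simp) hy (by rw [Function.update_of_ne (by omega), hv])

theorem eval_isolated (hL : IsListing L F) (hF : IsDCNF d F) {ρ : ℕ → ℕ} {x : ℕ} {u : Fin n}
    (hx : x < 3) (hu : ρ x = u) :
    (Term.isolated d x).eval (input L k) ρ = if u ∈ isolated F then 1 else 0 := by
  rw [Term.isolated, Term.eval_neg, hL.eval_deg hF hx hu]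
  simp [isolated]

theorem eval_sum_numVars (L : List (List (Lit n))) (k : ℕ) (ρ : ℕ → ℕ) (i : ℕ) (q : Term) :
    (Term.sum i Term.numVars q).eval (input L k) ρ =
      ∑ u : Fin n, q.eval (input L k) (Function.update ρ i u) := by
  rw [Term.eval, show Term.numVars.eval (input L k) ρ = n from rfl, Finset.sum_range]

theorem eval_safe (hL : IsListing L F) (hF : IsDCNF d F) {ρ : ℕ → ℕ} {x : ℕ} {u : Fin n}
    (hx : x < 2) (hu : ρ x = u) :
    (Term.safe d x).eval (input L k) ρ = if u ∈ safe F then 1 else 0 := by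
  rw [Term.safe, Term.eval_conj, hL.eval_isolated hF (by omega) hu, Term.eval_neg]
  refine if_congr (Iff.trans (and_congr (by simp) ?_) Finset.mem_filter.symm) rfl rfl
  simp only [ite_ne_right_iff, ne_eq, one_ne_zero, not_false_eq_true, and_true]
  rw [eval_sum_numVars, Finset.sum_eq_zero_iff]
  simp only [Finset.mem_univ, true_imp_iff]
  refine forall_congr' fun v => ?_
  have hu' : Function.update ρ 2 (v : ℕ) x = u := by rw [Function.update_of_ne (by omega), hu]
  simp only [Term.eval_conj, Term.eval_neg, Term.eval_eq,
    hL.eval_isolated hF (u := v) (show 2 < 3 by omega) (Function.update_self 2 (v : ℕ) ρ),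
    hL.eval_cooccur hF (u := u) (v := v) (by omega) hu' (show 2 < 3 by omega)
      (Function.update_self 2 (v : ℕ) ρ), Term.eval, hu', Function.update_self, ← Fin.ext_iff]
  by_cases h1 : u = v <;> by_cases h2 : v ∈ isolated F <;> simp [h1, h2]

theorem eval_low (hL : IsListing L F) (hF : IsDCNF d F) {ρ : ℕ → ℕ} {x : ℕ} {u : Fin n}
    (hx : x < 2) (hu : ρ x = u) :
    (Term.low d x).eval (input L k) ρ ≠ 0 ↔ Low F k u := by
  rw [Term.low, eval_sum_numVars, Ne, Finset.sum_eq_zero_iff, Low]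
  simp only [Finset.mem_univ, true_imp_iff, not_forall]
  refine exists_congr fun v => ?_
  have hu' : Function.update ρ 2 (v : ℕ) x = u := by rw [Function.update_of_ne (by omega), hu]
  have hmin : n - (n - k) - 1 = min n k - 1 := by omega
  rw [Term.eval_le, hL.eval_deg hF (u := u) (by omega) hu', Term.eval]
  simp only [Term.eval, Term.numVars, Term.wt]
  rw [Finset.sum_congr rfl fun i _ => hL.eval_codeg hF (u := u) (v := v) (by omega)
      (by rw [Function.update_of_ne (by omega), hu']) (by omega) (by simp)]
  simp [input, hmin]

theorem eval_numIsolated (hL : IsListing L F) (hF : IsDCNF d F) (ρ : ℕ → ℕ) :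
    (Term.numIsolated d).eval (input L k) ρ = (isolated F).card := by
  rw [Term.numIsolated, eval_sum_numVars,
    Finset.sum_congr rfl fun u _ => hL.eval_isolated hF (u := u) (by omega) (by simp)]
  simp

theorem eval_numSafe (hL : IsListing L F) (hF : IsDCNF d F) (ρ : ℕ → ℕ) :
    (Term.numSafe d).eval (input L k) ρ = (safe F).card := by
  rw [Term.numSafe, eval_sum_numVars,
    Finset.sum_congr rfl fun u _ => hL.eval_safe hF (u := u) (by omega) (by simp)]
  simp

theorem eval_obstructions (hL : IsListing L F) (hF : IsDCNF d F) (ρ : ℕ → ℕ) :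
    (Term.obstructions d).eval (input L k) ρ = 0 ↔
      ∀ x y, Low F k x → Low F k y → codeg F x y = 0 := by
  rw [Term.obstructions, eval_sum_numVars, Finset.sum_eq_zero_iff]
  simp only [Finset.mem_univ, true_imp_iff]
  refine forall_congr' fun u => ?_
  rw [eval_sum_numVars, Finset.sum_eq_zero_iff]
  simp only [Finset.mem_univ, true_imp_iff]
  refine forall_congr' fun v => ?_
  set σ := Function.update (Function.update ρ 0 (u : ℕ)) 1 (v : ℕ) with hσ
  have h0 : σ 0 = u := by simp [hσ]
  have h1 : σ 1 = v := by simp [hσ]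
  simp only [Term.eval_conj, hL.eval_low hF (u := u) (show 0 < 2 by omega) h0,
    hL.eval_low hF (u := v) (show 1 < 2 by omega) h1,
    hL.eval_codeg hF (u := u) (v := v) (show 0 < 3 by omega) h0 (show 1 < 3 by omega) h1]
  by_cases h1 : Low F k u <;> by_cases h2 : Low F k v <;> simp [h1, h2]

theorem eval_refuted (hL : IsListing L F) (hF : IsDCNF d F) (ρ : ℕ → ℕ) :
    (Term.refuted d).eval (input L k) ρ =
      if ¬ k ≤ (safe F).card ∧ Refuted F k then 1 else 0 := by
  have hk : Term.wt.eval (input L k) ρ = k := rfl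
  rw [Term.refuted, Term.eval_conj, Term.eval_neg, Term.eval_le, Term.eval_conj, Term.eval_neg,
    Term.eval_le, Term.eval_neg, hL.eval_numSafe hF, hL.eval_numIsolated hF, hk]
  simp only [Refuted]
  have := hL.eval_obstructions (k := k) hF ρ
  by_cases h1 : k ≤ (safe F).card <;> by_cases h2 : k ≤ (isolated F).card <;>
    by_cases h3 : (Term.obstructions d).eval (input L k) ρ = 0 <;> simp_all

theorem eval_verdict (hL : IsListing L F) (hF : IsDCNF d F) (ρ : ℕ → ℕ) :
    (Term.verdict d).eval (input L k) ρ =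
      if k ≤ (safe F).card then 1 else if Refuted F k then 2 else 0 := by
  have hk : Term.wt.eval (input L k) ρ = k := rfl
  rw [Term.verdict, Term.eval, Term.eval_le, Term.eval, hL.eval_refuted hF, hL.eval_numSafe hF, hk]
  split_ifs <;> first | rfl | tauto

theorem eval_output (hL : IsListing L F) (hF : IsDCNF d F) {ρ : ℕ → ℕ} {u : Fin n}
    (hu : ρ 0 = u) : (Term.output d).eval (input L k) ρ =
      if u ∈ firstElements (safe F) k then 1 else 0 := by
  have hk : Term.wt.eval (input L k) ρ = k := rfl
  have hsum : (Term.sum 1 Term.numVars (.conj (.neg (.le (.var 0) (.var 1)))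
      (Term.safe d 1))).eval (input L k) ρ = ((safe F).filter (· < u)).card := by
    rw [eval_sum_numVars, Finset.card_filter, ← Finset.sum_filter_add_sum_filter_not
      Finset.univ (· ∈ safe F), Finset.sum_eq_zero (s := Finset.univ.filter (· ∉ safe F)), add_zero]
    · rw [Finset.filter_univ_mem]
      refine Finset.sum_congr rfl fun v hv => ?_
      rw [Term.eval_conj, hL.eval_safe hF (u := v) (by omega) (by simp), Term.eval_neg,
        Term.eval_le, if_pos hv]
      simp only [Term.eval, Function.update_self]
      rw [Function.update_of_ne (by omega), hu]
      simp only [Fin.val_fin_le]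
      by_cases h : u ≤ v <;> simp [h]
    · intro v hv
      rw [Term.eval_conj, hL.eval_safe hF (u := v) (by omega) (by simp),
        if_neg (Finset.mem_filter.1 hv).2]
      simp
  rw [Term.output, Term.eval_conj, hL.eval_safe hF (by omega) hu, Term.eval_neg, Term.eval_le,
    hsum, hk]
  simp only [firstElements, Finset.mem_filter]
  by_cases h : u ∈ safe F <;> by_cases h' : k ≤ ((safe F).filter (· < u)).card <;> simp [h, h']

end IsListing

/-! ## The program -/

/-- The program: compute the verdict, and then the output assignment, variable by variable. -/
def solver (d : ℕ) : Program :=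
  .seq ((Term.verdict d).compile 0) (.seq (.store 3 (.const 0) (.cell 6 (.const 0)))
    (.seq (.store 5 (.const 0) (.const 0))
      (.loop (.sub (.cell 0 (.const 0)) (.cell 5 (.const 0)))
        (.seq ((Term.output d).compile 0) (.seq (.store 4 (.cell 5 (.const 0)) (.cell 6 (.const 0)))
          (.store 5 (.const 0) (.add (.cell 5 (.const 0)) (.const 1))))))))

theorem runs_solver {n d N k : ℕ} {F : Formula n} (hF : IsDCNF d F) {L : List (List (Lit n))}
    (hL : IsListing L F) (hn : n ≤ N) (hm : F.card ≤ N) (hd : d ≤ N) :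
    ∃ M, Runs (solver d) (input L k)
        ((Term.verdict d).time N + N * ((Term.output d).time N + 20) + 20) M ∧
      verdict M = (if k ≤ (safe F).card then 1 else if Refuted F k then 2 else 0) ∧
      ∀ x : Fin n, M 4 x = if x ∈ firstElements (safe F) k then 1 else 0 := by
  have hm' : input L k 0 2 ≤ N := by
    rw [← hL.length_eq] at hm
    exact hm
  obtain ⟨M₁, h₁, hv₁, hf₁⟩ := Term.runs_compile _
    (Term.bounded_verdict (I := input L k) hn hm' hd) 0 (input L k) fun _ _ => rfl
  rw [hL.eval_verdict hF] at hv₁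
  set V := if k ≤ (safe F).card then 1 else if Refuted F k then 2 else 0 with hV
  have e₁ : Runs (.store 3 (.const 0) (.cell 6 (.const 0))) M₁ 4 (M₁.write 3 0 V) :=
    Runs.store _ _ _ _ rfl hv₁
  have e₂ : Runs (.store 5 (.const 0) (.const 0)) (M₁.write 3 0 V) 3
      ((M₁.write 3 0 V).write 5 0 0) := Runs.store _ _ _ _ rfl rfl
  -- Cell `0` of array `5` is the loop counter and also the named variable that `output` reads.
  let Inv : ℕ → Memory → Prop := fun j R => (∀ a < 3, R a = input L k a) ∧ R 3 0 = V ∧ R 5 0 = j ∧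
    ∀ x : Fin n, (x : ℕ) < j → R 4 x = if x ∈ firstElements (safe F) k then 1 else 0
  have htest : ∀ j ≤ n, ∀ R, Inv j R →
      (AExp.sub (.cell 0 (.const 0)) (.cell 5 (.const 0))).eval R = n - j := by
    rintro j - R ⟨hR, -, hR5, -⟩
    simp [AExp.eval, hR5, hR 0 (by omega), input]
  have hbody : ∀ j < n, ∀ R, Inv j R → ∃ R', Runs (.seq ((Term.output d).compile 0)
      (.seq (.store 4 (.cell 5 (.const 0)) (.cell 6 (.const 0)))
        (.store 5 (.const 0) (.add (.cell 5 (.const 0)) (.const 1))))) R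
      ((Term.output d).time N + 11) R' ∧ Inv (j + 1) R' := by
    rintro j hj R ⟨hR, hR3, hR5, hR4⟩
    obtain ⟨R₁, g₁, gv₁, gf₁⟩ := Term.runs_compile _
      (Term.bounded_output (I := input L k) hn hm' hd) 0 R hR
    have hR5' : R₁ 5 0 = j := by rw [gf₁ 5 0 (by omega), hR5]
    rw [hL.eval_output hF (u := ⟨j, hj⟩) hR5] at gv₁
    have g₂ : Runs (.store 4 (.cell 5 (.const 0)) (.cell 6 (.const 0))) R₁ 5
        (R₁.write 4 j (if (⟨j, hj⟩ : Fin n) ∈ firstElements (safe F) k then 1 else 0)) :=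
      Runs.store _ _ _ _ hR5' gv₁
    refine ⟨_, (g₁.seq (g₂.seq (Runs.store 5 _ _ _ rfl rfl))).mono ?_, ?_, ?_, ?_, ?_⟩
    · simp [AExp.cost]
    · intro a ha
      rw [← hR a ha]
      funext x
      simp only [Memory.write_apply]
      rw [if_neg (by omega), if_neg (by omega), gf₁ _ _ (by omega)]
    · simp [Memory.write_apply, gf₁ 3 0 (by omega), hR3]
    · simp [Memory.write_apply, AExp.eval, hR5']
    · intro x hx
      rw [Memory.write_apply, if_neg (by omega), Memory.write_apply]
      by_cases hxj : x = ⟨j, hj⟩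
      · subst hxj
        rw [if_pos ⟨rfl, rfl⟩]
      · have : (x : ℕ) ≠ j := fun h => hxj (Fin.ext h)
        rw [if_neg (by omega), gf₁ _ _ (by omega), hR4 x (by omega)]
  have hI : Inv 0 ((M₁.write 3 0 V).write 5 0 0) := by
    refine ⟨?_, ?_, ?_, ?_⟩
    · intro a ha
      funext x
      simp only [Memory.write_apply]
      rw [if_neg (by omega), if_neg (by omega), hf₁ _ _ (by omega)]
    · simp [Memory.write_apply]
    · simp [Memory.write_apply]
    · intro x hx
      omega
  obtain ⟨R, hR, -, hR3, -, hR4⟩ := Runs.loop htest hbody hI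
  refine ⟨R, (h₁.seq (e₁.seq (e₂.seq hR))).mono ?_, hR3, fun x => hR4 x x.2⟩
  have h1 : n * ((Term.output d).time N + 16) ≤ N * ((Term.output d).time N + 16) :=
    Nat.mul_le_mul_right _ hn
  simp only [AExp.cost]
  ring_nf at h1 ⊢
  omega

theorem IsDCNF.card_le {n d : ℕ} {F : Formula n} (hF : IsDCNF d F) : F.card ≤ (2 * n) ^ d := by
  have h : F ⊆ Finset.powersetCard d Finset.univ := fun C hC =>
    Finset.mem_powersetCard.2 ⟨Finset.subset_univ _, hF C hC⟩
  refine (Finset.card_le_card h).trans ?_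
  rw [Finset.card_powersetCard]
  refine (Nat.choose_le_pow _ _).trans (le_of_eq ?_)
  simp [mul_comm]

theorem exists_solver_time_le (d : ℕ) : ∃ A e : ℕ, ∀ (n k : ℕ), 1 ≤ n → ∀ (F : Formula n),
    IsDCNF d F → ∀ (L : List (List (Lit n))), IsListing L F →
      ∃ M, Runs (solver d) (input L k) (A * n ^ e) M ∧
        verdict M = (if k ≤ (safe F).card then 1 else if Refuted F k then 2 else 0) ∧
        ∀ x : Fin n, M 4 x = if x ∈ firstElements (safe F) k then 1 else 0 := by
  obtain ⟨C, D, h⟩ := (Term.verdict d).exists_time_le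
  obtain ⟨C', D', h'⟩ := (Term.output d).exists_time_le
  let K := 2 ^ d + d + 2
  let E := D + D' + 1
  refine ⟨(C + C' + 40) * K ^ E, (d + 1) * E, fun n k hn F hF L hL => ?_⟩
  -- `N` dominates the number of variables, the clause bound `(2 * n) ^ d`, and `d`.
  let N := 2 ^ d * n ^ d + n + d
  have hN : N + 1 ≤ K * n ^ (d + 1) := by
    have h1 : n ^ d ≤ n ^ (d + 1) := Nat.pow_le_pow_right hn (by omega)
    have h2 : n ≤ n ^ (d + 1) := Nat.le_self_pow (by omega) n
    have h3 : 1 ≤ n ^ (d + 1) := Nat.one_le_pow _ _ hn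
    simp only [N, K]
    nlinarith [Nat.mul_le_mul_left (2 ^ d) h1, Nat.mul_le_mul_left d h3]
  obtain ⟨M, hM, hM'⟩ := runs_solver (N := N) (k := k) hF hL (by simp only [N]; omega)
    (hF.card_le.trans (by rw [mul_pow]; simp only [N]; omega)) (by simp only [N]; omega)
  refine ⟨M, hM.mono ?_, hM'⟩
  have p1 : (N + 1) ^ D ≤ (N + 1) ^ E := Nat.pow_le_pow_right (by omega) (by simp only [E]; omega)
  have p2 : (N + 1) ^ (D' + 1) ≤ (N + 1) ^ E :=
    Nat.pow_le_pow_right (by omega) (by simp only [E]; omega)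
  have p3 : N + 1 ≤ (N + 1) ^ E := Nat.le_self_pow (by simp only [E]; omega) _
  have p4 : (N + 1) ^ E ≤ K ^ E * n ^ ((d + 1) * E) := by
    rw [pow_mul, ← mul_pow]
    exact Nat.pow_le_pow_left hN E
  have q1 : N * (Term.output d).time N ≤ C' * (N + 1) ^ (D' + 1) := by
    calc _ ≤ (N + 1) * (C' * (N + 1) ^ D') := Nat.mul_le_mul (by omega) (h' N)
      _ = _ := by ring
  calc (Term.verdict d).time N + N * ((Term.output d).time N + 20) + 20
      ≤ C * (N + 1) ^ D + C' * (N + 1) ^ (D' + 1) + 20 * (N + 1) := by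
        have := h N
        rw [mul_add]
        omega
    _ ≤ (C + C' + 40) * (N + 1) ^ E := by
        nlinarith [Nat.mul_le_mul_left C p1, Nat.mul_le_mul_left C' p2]
    _ ≤ (C + C' + 40) * (K ^ E * n ^ ((d + 1) * E)) := Nat.mul_le_mul_left _ p4
    _ = _ := by ring

theorem answers_of_le_safe {n k : ℕ} (hk : 1 ≤ k) {F : Formula n} {M : Memory}
    (hv : verdict M = 1) (hs : k ≤ (safe F).card)
    (hM : ∀ x : Fin n, M 4 x = if x ∈ firstElements (safe F) k then 1 else 0) :
    Answers F k M := by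
  have hout : outputAssignment n M = fun x => decide (x ∈ firstElements (safe F) k) := by
    funext x
    by_cases h : x ∈ firstElements (safe F) k <;> simp [outputAssignment, hM, h]
  have hcard : (firstElements (safe F) k).card = k := by
    rw [card_firstElements, min_eq_left hs]
  refine Or.inl ⟨hv, ?_, ?_⟩
  · rw [hout]
    exact satisfies_of_subset_safe (Finset.filter_subset _ _)
      (Finset.card_pos.1 (by omega))
  · rw [hout, weight]
    simp [hcard]

theorem answers_or_fails {n k : ℕ} (hk : 1 ≤ k) {F : Formula n} {M : Memory}
    (hv : verdict M = (if k ≤ (safe F).card then 1 else if Refuted F k then 2 else 0))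
    (hM : ∀ x : Fin n, M 4 x = if x ∈ firstElements (safe F) k then 1 else 0) :
    (k ≤ (safe F).card ∨ Refuted F k → Answers F k M) ∧ (Answers F k M ∨ Fails M) := by
  split_ifs at hv with h1 h2
  · have := answers_of_le_safe hk hv h1 hM
    exact ⟨fun _ => this, Or.inl this⟩
  · have : Answers F k M := Or.inr ⟨hv, not_exists_of_refuted h2⟩
    exact ⟨fun _ => this, Or.inl this⟩
  · exact ⟨fun h => absurd h (by tauto), Or.inr hv⟩

end WSat
namespace WSat

/-! ## Weighted sums over samples -/

section Expectation

variable {n d : ℕ}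

/-- The probability of a single draw. -/
noncomputable def drawWeight (p : ℝ) (S : Finset (Fin n)) : Draw n → ℝ
  | none => 1 - p
  | some N => if N ∈ S.powerset.erase ∅ then p / (2 ^ S.card - 1) else 0

/-- The expectation of `g` under `sampleLaw n d p`. -/
noncomputable def expect (p : ℝ) (g : Sample n d → ℝ) : ℝ :=
  ∑ ω, (∏ S, drawWeight p S.1 (ω S)) * g ω

/-- Every selected clause has a negated literal. -/
def Sample.Proper (ω : Sample n d) : Prop :=
  ∀ S N, ω S = some N → N ∈ S.1.powerset.erase ∅

theorem one_le_two_pow (m : ℕ) : (1 : ℝ) ≤ 2 ^ m := one_le_pow₀ (by norm_num)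

theorem drawWeight_nonneg {p : ℝ} (h0 : 0 ≤ p) (h1 : p ≤ 1) (S : Finset (Fin n)) (v : Draw n) :
    0 ≤ drawWeight p S v := by
  have := one_le_two_pow S.card
  cases v with
  | none => exact sub_nonneg.2 h1
  | some N =>
    simp only [drawWeight]
    split_ifs
    · exact div_nonneg h0 (by linarith)
    · exact le_rfl

theorem drawLaw_singleton (p : ℝ) (S : Finset (Fin n)) (v : Draw n) :
    drawLaw p S {v} = ENNReal.ofReal (drawWeight p S v) := by
  cases v with
  | none => simp [drawLaw, drawWeight]
  | some N =>
    simp only [drawLaw, drawWeight, Measure.add_apply, Measure.smul_apply, smul_eq_mul,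
      Measure.finsetSum_apply]
    have h : ∀ N' : Finset (Fin n), ENNReal.ofReal (p / (2 ^ S.card - 1)) *
        Measure.dirac (some N' : Draw n) {some N} =
        if N = N' then ENNReal.ofReal (p / (2 ^ S.card - 1)) else 0 := by
      intro N'
      by_cases h : N = N'
      · simp [h]
      · simp [h, Ne.symm h]
    simp only [h, Finset.sum_ite_eq]
    split_ifs <;> simp

/-- Supplies the σ-finiteness that product measures of singletons require. -/
instance (p : ℝ) (S : Finset (Fin n)) : IsFiniteMeasure (drawLaw p S) := by
  refine ⟨?_⟩
  simp only [drawLaw, Measure.add_apply, Measure.smul_apply, Measure.finsetSum_apply, smul_eq_mul,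
    measure_univ, mul_one]
  exact ENNReal.add_lt_top.2 ⟨ENNReal.ofReal_lt_top,
    ENNReal.sum_lt_top.2 fun _ _ => ENNReal.ofReal_lt_top⟩

theorem prod_drawWeight_nonneg {p : ℝ} (h0 : 0 ≤ p) (h1 : p ≤ 1) (ω : Sample n d) :
    0 ≤ ∏ S, drawWeight p S.1 (ω S) :=
  Finset.prod_nonneg fun _ _ => drawWeight_nonneg h0 h1 _ _

theorem sampleLaw_singleton {p : ℝ} (h0 : 0 ≤ p) (h1 : p ≤ 1) (ω : Sample n d) :
    sampleLaw n d p {ω} = ENNReal.ofReal (∏ S, drawWeight p S.1 (ω S)) := by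
  rw [sampleLaw, Measure.pi_singleton,
    ENNReal.ofReal_prod_of_nonneg fun _ _ => drawWeight_nonneg h0 h1 _ _]
  exact Finset.prod_congr rfl fun S _ => drawLaw_singleton p S.1 _

/-- Markov's inequality; improper samples have weight zero and need no bound. -/
theorem sampleLaw_le_expect {p : ℝ} (h0 : 0 ≤ p) (h1 : p ≤ 1) {A : Set (Sample n d)}
    {g : Sample n d → ℝ} (hg : ∀ ω, 0 ≤ g ω) (hA : ∀ ω ∈ A, ω.Proper → 1 ≤ g ω) :
    sampleLaw n d p A ≤ ENNReal.ofReal (expect p g) := by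
  classical
  have hA' : A = ↑(Finset.univ.filter fun ω => ω ∈ A) := by simp
  rw [hA', ← sum_measure_singleton, expect, ENNReal.ofReal_sum_of_nonneg fun ω _ =>
    mul_nonneg (prod_drawWeight_nonneg h0 h1 ω) (hg ω)]
  refine (Finset.sum_le_sum fun ω hω => ?_).trans (Finset.sum_le_sum_of_subset
    (Finset.filter_subset _ _))
  rw [sampleLaw_singleton h0 h1]
  refine ENNReal.ofReal_le_ofReal ?_
  by_cases hω' : ω.Proper
  · exact le_mul_of_one_le_right (prod_drawWeight_nonneg h0 h1 ω)
      (hA ω (Finset.mem_filter.1 hω).2 hω')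
  · simp only [Sample.Proper, not_forall] at hω'
    obtain ⟨S, N, hN, hS⟩ := hω'
    rw [Finset.prod_eq_zero (Finset.mem_univ S) (by simp only [hN, drawWeight]; rw [if_neg hS]),
      zero_mul]

theorem expect_sum {ι : Type*} (p : ℝ) (s : Finset ι) (g : ι → Sample n d → ℝ) :
    expect p (fun ω => ∑ i ∈ s, g i ω) = ∑ i ∈ s, expect p (g i) := by
  simp only [expect, Finset.mul_sum]
  exact Finset.sum_comm

theorem expect_add (p : ℝ) (g h : Sample n d → ℝ) :
    expect p (fun ω => g ω + h ω) = expect p g + expect p h := by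
  simp only [expect, mul_add, Finset.sum_add_distrib]

theorem expect_const_mul (p c : ℝ) (g : Sample n d → ℝ) :
    expect p (fun ω => c * g ω) = c * expect p g := by
  simp only [expect, Finset.mul_sum]
  exact Finset.sum_congr rfl fun _ _ => by ring

/-- Independence of the draws, as the expansion of a product of sums. -/
theorem expect_prod (p : ℝ) (f : DSet n d → Draw n → ℝ) :
    expect p (fun ω => ∏ S, f S (ω S)) = ∏ S, ∑ v, drawWeight p S.1 v * f S v := by
  rw [Finset.prod_univ_sum, Fintype.piFinset_univ, expect]
  exact Finset.sum_congr rfl fun _ _ => Finset.prod_mul_distrib.symm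

theorem sum_drawWeight_mul (p : ℝ) (S : DSet n d) (f : Draw n → ℝ) :
    ∑ v, drawWeight p S.1 v * f v =
      (1 - p) * f none + p / (2 ^ d - 1) * ∑ N ∈ S.1.powerset.erase ∅, f (some N) := by
  rw [Fintype.sum_option]
  congr 1
  simp only [drawWeight, ite_mul, zero_mul]
  rw [Finset.sum_ite_mem, Finset.univ_inter, S.2, Finset.mul_sum]

theorem card_erase_powerset (S : DSet n d) : ((S.1.powerset.erase ∅).card : ℝ) = 2 ^ d - 1 := by
  rw [Finset.card_erase_of_mem (Finset.empty_mem_powerset _), Finset.card_powerset, S.2,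
    Nat.cast_sub Nat.one_le_two_pow]
  simp

theorem sum_drawWeight_drawn (hd : d ≠ 0) (p : ℝ) (S : DSet n d) :
    ∑ v, drawWeight p S.1 v * (if v = none then 0 else 1) = p := by
  have : (2 : ℝ) ^ d - 1 ≠ 0 := by
    have : (1 : ℝ) < 2 ^ d := one_lt_pow₀ (by norm_num) hd
    linarith
  rw [sum_drawWeight_mul]
  simp only [if_true, reduceCtorEq, if_false, Finset.sum_const, nsmul_eq_mul,
    card_erase_powerset]
  field_simp
  ring

theorem sum_drawWeight (hd : d ≠ 0) (p : ℝ) (S : DSet n d) :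
    ∑ v, drawWeight p S.1 v = 1 := by
  have : (2 : ℝ) ^ d - 1 ≠ 0 := by
    have : (1 : ℝ) < 2 ^ d := one_lt_pow₀ (by norm_num) hd
    linarith
  have h := sum_drawWeight_mul p S fun _ => 1
  simp only [mul_one, Finset.sum_const, nsmul_eq_mul, card_erase_powerset] at h
  rw [h]
  field_simp
  ring

theorem drawWeight_negate (p : ℝ) (S : DSet n d) {x : Fin n} (hx : x ∈ S.1) :
    drawWeight p S.1 (some {x}) = p / (2 ^ d - 1) := by
  simp [drawWeight, hx, S.2]

theorem sum_drawWeight_negate (hd : d ≠ 0) (p s : ℝ) (S : DSet n d) {x : Fin n} (hx : x ∈ S.1) :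
    ∑ v, drawWeight p S.1 v * (if v = some {x} then s else 1) =
      1 - p / (2 ^ d - 1) * (1 - s) := by
  have h : ∀ v : Draw n, drawWeight p S.1 v * (if v = some {x} then s else 1) =
      drawWeight p S.1 v - if v = some {x} then drawWeight p S.1 v * (1 - s) else 0 := by
    intro v
    split_ifs <;> ring
  simp only [h, Finset.sum_sub_distrib, sum_drawWeight hd, Finset.sum_ite_eq', Finset.mem_univ,
    if_true, drawWeight_negate p S hx]

/-- The two excluded outcomes are disjoint, so their probabilities add. -/
theorem sum_drawWeight_negate_two (hd : d ≠ 0) (p : ℝ) (S : DSet n d) {x y : Fin n}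
    (hxy : x ≠ y) (hx : x ∈ S.1) (hy : y ∈ S.1) :
    ∑ v, drawWeight p S.1 v *
      ((if v = some {x} then 0 else 1) * (if v = some {y} then 0 else 1)) =
      1 - 2 * (p / (2 ^ d - 1)) := by
  have h : ∀ v : Draw n, drawWeight p S.1 v *
      ((if v = some {x} then 0 else 1) * (if v = some {y} then 0 else 1)) =
      drawWeight p S.1 v - (if v = some {x} then drawWeight p S.1 v else 0) -
        if v = some {y} then drawWeight p S.1 v else 0 := by
    intro v
    split_ifs with h1 h2
    · subst h1
      simp [hxy] at h2
    all_goals ring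
  simp only [h, Finset.sum_sub_distrib, sum_drawWeight hd, Finset.sum_ite_eq', Finset.mem_univ,
    if_true, drawWeight_negate p S hx, drawWeight_negate p S hy]
  ring

end Expectation

/-! ## Counting `d`-sets -/

section Counting

variable {n d : ℕ}

/-- Removing `A` maps these sets bijectively to the `(d - |A|)`-subsets of the complement of `A ∪
B`. -/
theorem card_dset_filter {A B : Finset (Fin n)} (hAB : Disjoint A B) (hA : A.card ≤ d) :
    ((Finset.univ : Finset (DSet n d)).filter fun S => A ⊆ S.1 ∧ Disjoint S.1 B).card =
      (n - A.card - B.card).choose (d - A.card) := by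
  have hc : ((A ∪ B)ᶜ).card = n - A.card - B.card := by
    rw [Finset.card_compl, Finset.card_union_of_disjoint hAB, Fintype.card_fin, Nat.sub_sub]
  rw [← hc, ← Finset.card_powersetCard]
  refine Finset.card_bij (fun S _ => S.1 \ A) ?_ ?_ ?_
  · intro S hS
    obtain ⟨h1, h2⟩ := (Finset.mem_filter.1 hS).2
    rw [Finset.mem_powersetCard, Finset.card_sdiff_of_subset h1, S.2]
    refine ⟨fun x hx => ?_, rfl⟩
    rw [Finset.mem_sdiff] at hx
    simp only [Finset.mem_compl, Finset.mem_union, not_or]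
    exact ⟨hx.2, Finset.disjoint_left.1 h2 hx.1⟩
  · intro S hS S' hS' h
    refine Subtype.ext ?_
    rw [← Finset.sdiff_union_of_subset (Finset.mem_filter.1 hS).2.1, h,
      Finset.sdiff_union_of_subset (Finset.mem_filter.1 hS').2.1]
  · intro U hU
    obtain ⟨h1, h2⟩ := Finset.mem_powersetCard.1 hU
    have hUA : Disjoint U A := Finset.disjoint_left.2 fun x hx hxA => by
      simpa [hxA] using h1 hx
    have hUB : Disjoint U B := Finset.disjoint_left.2 fun x hx hxB => by
      simpa [hxB] using h1 hx
    refine ⟨⟨U ∪ A, by rw [Finset.card_union_of_disjoint hUA, h2]; omega⟩, ?_, ?_⟩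
    · simp only [Finset.mem_filter, Finset.mem_univ, true_and]
      exact ⟨Finset.subset_union_right, Finset.disjoint_union_left.2 ⟨hUB, hAB⟩⟩
    · exact Finset.union_sdiff_cancel_right hUA

theorem card_dset_mem (hd : 1 ≤ d) (x : Fin n) :
    ((Finset.univ : Finset (DSet n d)).filter fun S => x ∈ S.1).card =
      (n - 1).choose (d - 1) := by
  have h := card_dset_filter (d := d) (A := {x}) (B := ∅) (by simp) (by simpa using hd)
  simpa using h

theorem card_dset_mem_notMem (hd : 1 ≤ d) {x y : Fin n} (hxy : x ≠ y) :
    ((Finset.univ : Finset (DSet n d)).filter fun S => x ∈ S.1 ∧ y ∉ S.1).card =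
      (n - 2).choose (d - 1) := by
  have h := card_dset_filter (d := d) (A := {x}) (B := {y}) (by simpa using hxy)
    (by simpa using hd)
  simpa [Nat.sub_sub] using h

theorem card_dset_mem_mem_le (hd : 2 ≤ d) {x y : Fin n} (hxy : x ≠ y) :
    ((Finset.univ : Finset (DSet n d)).filter fun S => x ∈ S.1 ∧ y ∈ S.1).card ≤
      n ^ (d - 2) := by
  have hc : ({x, y} : Finset (Fin n)).card = 2 := Finset.card_pair hxy
  have h := card_dset_filter (d := d) (A := {x, y}) (B := ∅) (by simp) (by rw [hc]; exact hd)
  simp only [Finset.insert_subset_iff, Finset.singleton_subset_iff, Finset.disjoint_empty_right,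
    and_true, hc, Finset.card_empty] at h
  rw [h]
  exact (Nat.choose_le_pow _ _).trans (Nat.pow_le_pow_left (by omega) _)

end Counting

/-! ## The formula of a sample -/

section SampleFormula

variable {n d : ℕ}

namespace Sample

/-- The `d`-sets on which a clause is selected in which only `x` is negated. -/
def negating (ω : Sample n d) (x : Fin n) : Finset (DSet n d) :=
  Finset.univ.filter fun S => x ∈ S.1 ∧ ω S = some {x}

/-- The `d`-sets containing `x` and `y` on which a clause is selected. -/
def joint (ω : Sample n d) (x y : Fin n) : Finset (DSet n d) :=
  Finset.univ.filter fun S => (x ∈ S.1 ∧ y ∈ S.1) ∧ ω S ≠ none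

theorem mem_formula {ω : Sample n d} {C : Clause n} :
    C ∈ ω.formula ↔ ∃ S N, ω S = some N ∧ C = clauseOn S.1 N := by
  simp only [formula, Finset.mem_biUnion, Finset.mem_univ, true_and]
  refine exists_congr fun S => ?_
  cases h : ω S <;> simp [drawClauses]

end Sample

theorem mem_clauseOn {S N : Finset (Fin n)} {l : Lit n} :
    l ∈ clauseOn S N ↔ l.1 ∈ S ∧ decide (l.1 ∉ N) = l.2 := by
  simp only [clauseOn, Finset.mem_image]
  constructor
  · rintro ⟨x, hx, rfl⟩
    exact ⟨hx, rfl⟩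
  · rintro ⟨h, h'⟩
    exact ⟨l.1, h, Prod.ext rfl h'⟩

theorem occurs_clauseOn {S N : Finset (Fin n)} {x : Fin n} : Occurs x (clauseOn S N) ↔ x ∈ S := by
  simp only [Occurs, mem_clauseOn]
  constructor
  · rintro ⟨l, ⟨hl, -⟩, rfl⟩
    exact hl
  · exact fun h => ⟨(x, decide (x ∉ N)), ⟨h, rfl⟩, rfl⟩

theorem clauseOn_left_injective {S S' N N' : Finset (Fin n)} (h : clauseOn S N = clauseOn S' N') :
    S = S' := by
  ext x
  rw [← occurs_clauseOn (N := N), h, occurs_clauseOn]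

theorem card_clauseOn (S N : Finset (Fin n)) : (clauseOn S N).card = S.card :=
  Finset.card_image_of_injective _ fun _ _ h => congrArg Prod.fst h

/-- Falsification means that on `S` exactly the variable `x` is negated. Nonemptiness of `N` then
forces `x ∈ S`; an all-positive clause avoiding `x` would also be falsified. -/
theorem falsified_clauseOn {S N : Finset (Fin n)} (hN : N ∈ S.powerset.erase ∅) {x : Fin n} :
    Falsified x (clauseOn S N) ↔ x ∈ S ∧ N = {x} := by
  obtain ⟨hne, hNS⟩ := Finset.mem_erase.1 hN
  rw [Finset.mem_powerset] at hNS
  have h : Falsified x (clauseOn S N) ↔ ∀ z ∈ S, z ∈ N ↔ z = x := by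
    constructor
    · intro h z hz
      have := h (z, decide (z ∉ N)) (mem_clauseOn.2 ⟨hz, rfl⟩)
      by_cases h1 : z = x <;> by_cases h2 : z ∈ N <;> simp_all
    · intro h l hl
      obtain ⟨hl1, hl2⟩ := mem_clauseOn.1 hl
      have := h _ hl1
      rw [← hl2]
      by_cases h1 : l.1 = x <;> by_cases h2 : l.1 ∈ N <;> simp_all
  rw [h]
  constructor
  · intro h
    obtain ⟨z, hz⟩ := Finset.nonempty_iff_ne_empty.2 hne
    have hzx := (h z (hNS hz)).1 hz
    subst hzx
    refine ⟨hNS hz, ?_⟩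
    ext w
    rw [Finset.mem_singleton]
    exact ⟨fun hw => (h w (hNS hw)).1 hw, fun hw => hw ▸ hz⟩
  · rintro ⟨-, rfl⟩ z -
    exact Finset.mem_singleton

/-! ### Degrees in the random formula and a criterion for success -/

namespace Sample

theorem isDCNF_formula (ω : Sample n d) : IsDCNF d ω.formula := by
  intro C hC
  obtain ⟨S, N, -, rfl⟩ := mem_formula.1 hC
  rw [card_clauseOn, S.2]

theorem Proper.deg_formula {ω : Sample n d} (hω : ω.Proper) (x : Fin n) :
    deg ω.formula x = (ω.negating x).card := by
  symm
  refine Finset.card_bij (fun S _ => clauseOn S.1 {x}) ?_ ?_ ?_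
  · intro S hS
    obtain ⟨hx, hS⟩ := (Finset.mem_filter.1 hS).2
    exact Finset.mem_filter.2 ⟨mem_formula.2 ⟨S, _, hS, rfl⟩,
      (falsified_clauseOn (hω S _ hS)).2 ⟨hx, rfl⟩⟩
  · intro S _ S' _ h
    exact Subtype.ext (clauseOn_left_injective h)
  · intro C hC
    obtain ⟨hC, hf⟩ := Finset.mem_filter.1 hC
    obtain ⟨S, N, hN, rfl⟩ := mem_formula.1 hC
    obtain ⟨hx, rfl⟩ := (falsified_clauseOn (hω S _ hN)).1 hf
    exact ⟨S, Finset.mem_filter.2 ⟨Finset.mem_univ _, hx, hN⟩, rfl⟩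

theorem Proper.codeg_formula_le {ω : Sample n d} (hω : ω.Proper) (x y : Fin n) :
    codeg ω.formula x y ≤ (ω.joint x y).card := by
  refine Finset.card_le_card_of_surjOn (fun S => clauseOn S.1 {x}) ?_
  intro C hC
  obtain ⟨hC, hf, hy⟩ := Finset.mem_filter.1 hC
  obtain ⟨S, N, hN, rfl⟩ := mem_formula.1 hC
  obtain ⟨hx, rfl⟩ := (falsified_clauseOn (hω S _ hN)).1 hf
  exact ⟨S, Finset.mem_coe.2 (Finset.mem_filter.2 ⟨Finset.mem_univ _,
    ⟨hx, (mem_clauseOn.1 hy).1⟩, by simp [hN]⟩), rfl⟩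

theorem Proper.mem_isolated {ω : Sample n d} (hω : ω.Proper) {x : Fin n} :
    x ∈ isolated ω.formula ↔ ω.negating x = ∅ := by
  rw [isolated, Finset.mem_filter, hω.deg_formula, Finset.card_eq_zero]
  simp

theorem exists_joint_of_notMem_safe {ω : Sample n d} {x : Fin n}
    (hx : x ∈ isolated ω.formula) (hs : x ∉ safe ω.formula) :
    ∃ y ∈ isolated ω.formula, x ≠ y ∧ (ω.joint x y).Nonempty := by
  rw [safe, Finset.mem_filter] at hs
  simp only [hx, true_and, not_forall, not_not] at hs
  obtain ⟨y, hy, hxy, C, hC, hxC, hyC⟩ := hs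
  obtain ⟨S, N, hN, rfl⟩ := mem_formula.1 hC
  rw [occurs_clauseOn] at hxC hyC
  exact ⟨y, hy, hxy, S, Finset.mem_filter.2 ⟨Finset.mem_univ _, ⟨hxC, hyC⟩, by simp [hN]⟩⟩

/-- If no pair of variables lies in three selected sets, and no two variables of small degree lie
in a common one, then the algorithm succeeds. -/
theorem Proper.decided {ω : Sample n d} (hω : ω.Proper) {k : ℕ}
    (h1 : ∀ x y, x ≠ y → (ω.joint x y).card ≤ 2)
    (h2 : ∀ x y, x ≠ y → (ω.negating x).card ≤ 2 * k → (ω.negating y).card ≤ 2 * k →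
      ω.joint x y = ∅) :
    k ≤ (safe ω.formula).card ∨ Refuted ω.formula k := by
  -- Isolated variables have degree 0, so `h2` already separates them.
  have hsafe : safe ω.formula = isolated ω.formula := by
    refine (Finset.filter_subset _ _).antisymm fun x hx => ?_
    by_contra hs
    obtain ⟨y, hy, hxy, hne⟩ := exists_joint_of_notMem_safe hx hs
    rw [hω.mem_isolated] at hx hy
    rw [h2 x y hxy (by simp [hx]) (by simp [hy])] at hne
    simp at hne
  -- Codegrees are at most 2 by `h1`, so being low bounds the degree by `2 * (k - 1)`.
  have hlow : ∀ x, Low ω.formula k x → (ω.negating x).card ≤ 2 * k := by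
    rintro x ⟨y, hy⟩
    rw [hω.deg_formula] at hy
    by_cases hxy : x = y
    · subst hxy
      rw [codeg_self] at hy
      omega
    · have hc := (hω.codeg_formula_le x y).trans (h1 x y hxy)
      calc _ ≤ _ := hy
        _ ≤ k * 2 := Nat.mul_le_mul (by omega) hc
        _ = _ := mul_comm _ _
  rw [or_iff_not_imp_left, not_le, hsafe]
  refine fun hk => ⟨hk, fun x y hx hy => ?_⟩
  by_cases hxy : x = y
  · subst hxy
    exact codeg_self _ _
  · have hc := hω.codeg_formula_le x y
    rw [h2 x y hxy (hlow x hx) (hlow y hy)] at hc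
    simpa using hc

end Sample

end SampleFormula

end WSat
namespace WSat

/-! ### Moment bounds for the failure probability -/

section Bounds

variable {n d : ℕ}

namespace Sample

/-! ### Triples of selected sets with two common variables -/

/-- The indicator of the event that clauses are selected on all sets in `T`. -/
noncomputable def allDrawn (ω : Sample n d) (T : Finset (DSet n d)) : ℝ :=
  ∏ S, if S ∈ T then (if ω S = none then 0 else 1) else 1

theorem allDrawn_nonneg (ω : Sample n d) (T : Finset (DSet n d)) : 0 ≤ ω.allDrawn T :=
  Finset.prod_nonneg fun _ _ => by split_ifs <;> norm_num

/-- The triples of `d`-sets that contain both `x` and `y`. -/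
def triples (n d : ℕ) (x y : Fin n) : Finset (Finset (DSet n d)) :=
  ((Finset.univ : Finset (DSet n d)).filter fun S => x ∈ S.1 ∧ y ∈ S.1).powersetCard 3

/-- The number of triples of selected sets, for all ordered pairs of common variables. -/
noncomputable def tripleSum (ω : Sample n d) : ℝ :=
  ∑ x : Fin n, ∑ y ∈ Finset.univ.erase x, ∑ T ∈ triples n d x y, ω.allDrawn T

theorem tripleSum_nonneg (ω : Sample n d) : 0 ≤ ω.tripleSum :=
  Finset.sum_nonneg fun _ _ => Finset.sum_nonneg fun _ _ => Finset.sum_nonneg fun _ _ =>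
    ω.allDrawn_nonneg _

theorem one_le_tripleSum {ω : Sample n d} {x y : Fin n} (hxy : x ≠ y)
    (h : 2 < (ω.joint x y).card) : 1 ≤ ω.tripleSum := by
  obtain ⟨T, hT, hT3⟩ := Finset.exists_subset_card_eq (show 3 ≤ (ω.joint x y).card from h)
  have hT' : T ∈ triples n d x y := by
    refine Finset.mem_powersetCard.2 ⟨fun S hS => ?_, hT3⟩
    exact Finset.mem_filter.2 ⟨Finset.mem_univ _, (Finset.mem_filter.1 (hT hS)).2.1⟩
  have h1 : ω.allDrawn T = 1 := by
    refine Finset.prod_eq_one fun S _ => ?_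
    split_ifs with h1 h2
    · exact absurd h2 (Finset.mem_filter.1 (hT h1)).2.2
    · rfl
    · rfl
  have h2 : ω.allDrawn T ≤ ∑ T ∈ triples n d x y, ω.allDrawn T :=
    Finset.single_le_sum (fun T _ => ω.allDrawn_nonneg T) hT'
  have h3 : ∑ T ∈ triples n d x y, ω.allDrawn T ≤
      ∑ y ∈ Finset.univ.erase x, ∑ T ∈ triples n d x y, ω.allDrawn T :=
    Finset.single_le_sum (f := fun y => ∑ T ∈ triples n d x y, ω.allDrawn T)
      (fun _ _ => Finset.sum_nonneg fun T _ => ω.allDrawn_nonneg T)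
      (Finset.mem_erase.2 ⟨hxy.symm, Finset.mem_univ y⟩)
  have h4 : ∑ y ∈ Finset.univ.erase x, ∑ T ∈ triples n d x y, ω.allDrawn T ≤ ω.tripleSum :=
    Finset.single_le_sum
      (f := fun x => ∑ y ∈ Finset.univ.erase x, ∑ T ∈ triples n d x y, ω.allDrawn T)
      (fun _ _ => Finset.sum_nonneg fun _ _ => Finset.sum_nonneg fun T _ => ω.allDrawn_nonneg T)
      (Finset.mem_univ x)
  linarith

theorem sum_pairs_le {f : Fin n → Fin n → ℝ} {c : ℝ} (hf : ∀ x y, x ≠ y → f x y ≤ c)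
    (hc : 0 ≤ c) : ∑ x : Fin n, ∑ y ∈ Finset.univ.erase x, f x y ≤ (n : ℝ) ^ 2 * c := by
  calc _ ≤ ∑ x : Fin n, ∑ y ∈ Finset.univ.erase x, c := Finset.sum_le_sum fun x _ =>
        Finset.sum_le_sum fun y hy => hf x y (Finset.ne_of_mem_erase hy).symm
    _ ≤ ∑ x : Fin n, ∑ y : Fin n, c := Finset.sum_le_sum fun x _ =>
        Finset.sum_le_sum_of_subset_of_nonneg (Finset.erase_subset _ _) fun _ _ _ => hc
    _ = _ := by simp; ring

theorem expect_tripleSum_le (hd : 2 ≤ d) {p : ℝ} (h0 : 0 ≤ p) :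
    expect p (tripleSum : Sample n d → ℝ) ≤ (n : ℝ) ^ 2 * (((n : ℝ) ^ (d - 2)) ^ 3 * p ^ 3) := by
  have hT : ∀ T : Finset (DSet n d), expect p (fun ω => ω.allDrawn T) = p ^ T.card := by
    intro T
    unfold allDrawn
    rw [expect_prod p fun S v => if S ∈ T then (if v = none then 0 else 1) else 1]
    rw [← Finset.prod_const, ← Finset.prod_subset (Finset.subset_univ T)]
    · refine Finset.prod_congr rfl fun S hS => ?_
      simp only [if_pos hS]
      exact sum_drawWeight_drawn (by omega) p S
    · intro S _ hS
      simp only [if_neg hS, mul_one]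
      exact sum_drawWeight (by omega) p S
  unfold tripleSum
  simp only [expect_sum, hT]
  refine sum_pairs_le (fun x y hxy => ?_) (by positivity)
  rw [Finset.sum_congr rfl fun T hT => by rw [(Finset.mem_powersetCard.1 hT).2], Finset.sum_const,
    triples, Finset.card_powersetCard, nsmul_eq_mul]
  refine mul_le_mul_of_nonneg_right ?_ (by positivity)
  have h1 := card_dset_mem_mem_le hd hxy
  have h2 := (Nat.choose_le_pow _ 3).trans (Nat.pow_le_pow_left h1 3)
  exact_mod_cast h2

/-! ### Selected sets with two variables of small degree -/

/-- The `d`-sets containing `x` but not `y` on which exactly `x` is negated. -/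
def negatingWithout (ω : Sample n d) (x y : Fin n) : Finset (DSet n d) :=
  Finset.univ.filter fun S => (x ∈ S.1 ∧ y ∉ S.1) ∧ ω S = some {x}

theorem negatingWithout_subset (ω : Sample n d) (x y : Fin n) :
    ω.negatingWithout x y ⊆ ω.negating x := fun S hS => by
  obtain ⟨-, ⟨h1, -⟩, h2⟩ := Finset.mem_filter.1 hS
  exact Finset.mem_filter.2 ⟨Finset.mem_univ _, h1, h2⟩

/-- The number of triples of two variables and a selected set that contains them, discounted
exponentially in the degrees of the variables. -/
noncomputable def discountedPairs (s : ℝ) (ω : Sample n d) : ℝ :=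
  ∑ x : Fin n, ∑ y ∈ Finset.univ.erase x,
    ∑ S ∈ (Finset.univ : Finset (DSet n d)).filter fun S => x ∈ S.1 ∧ y ∈ S.1,
      (if ω S = none then 0 else 1) *
        (s ^ (ω.negatingWithout x y).card * s ^ (ω.negatingWithout y x).card)

theorem expect_discountedPairs_le (hd : 2 ≤ d) {p s : ℝ} (h0 : 0 ≤ p)
    (hr : 0 ≤ 1 - p / (2 ^ d - 1) * (1 - s)) :
    expect p (discountedPairs s : Sample n d → ℝ) ≤ (n : ℝ) ^ 2 * ((n : ℝ) ^ (d - 2) *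
      (p * (1 - p / (2 ^ d - 1) * (1 - s)) ^ (2 * (n - 2).choose (d - 1)))) := by
  set r := 1 - p / (2 ^ d - 1) * (1 - s) with hr'
  -- `negatingWithout` ignores sets containing both variables. Thus `S₀` and the sets relevant to
  -- `x` and to `y` are disjoint families, and the expectation factors exactly.
  have key : ∀ x y : Fin n, x ≠ y → ∀ S₀ : DSet n d, x ∈ S₀.1 ∧ y ∈ S₀.1 →
      expect p (fun ω : Sample n d => (if ω S₀ = none then 0 else 1) *
        (s ^ (ω.negatingWithout x y).card * s ^ (ω.negatingWithout y x).card)) =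
      p * r ^ (2 * (n - 2).choose (d - 1)) := by
    intro x y hxy S₀ hS₀
    let f : DSet n d → Draw n → ℝ := fun S v =>
      (if S = S₀ then (if v = none then 0 else 1) else 1) *
      ((if x ∈ S.1 ∧ y ∉ S.1 then (if v = some {x} then s else 1) else 1) *
        (if y ∈ S.1 ∧ x ∉ S.1 then (if v = some {y} then s else 1) else 1))
    have hpow : ∀ (ω : Sample n d) (x y : Fin n), s ^ (ω.negatingWithout x y).card =
        ∏ S : DSet n d, if x ∈ S.1 ∧ y ∉ S.1 then (if ω S = some {x} then s else 1) else 1 := by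
      intro ω x y
      rw [← Finset.prod_const, negatingWithout, Finset.prod_filter]
      refine Finset.prod_congr rfl fun S _ => ?_
      rw [ite_and]
    have hf : (fun ω : Sample n d => (if ω S₀ = none then (0 : ℝ) else 1) *
        (s ^ (ω.negatingWithout x y).card * s ^ (ω.negatingWithout y x).card)) =
        fun ω => ∏ S, f S (ω S) := by
      funext ω
      rw [Finset.prod_mul_distrib, Finset.prod_mul_distrib, hpow, hpow, Finset.prod_ite_eq',
        if_pos (Finset.mem_univ _)]
    have hS : ∀ S : DSet n d, ∑ v, drawWeight p S.1 v * f S v = (if S = S₀ then p else 1) *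
        ((if x ∈ S.1 ∧ y ∉ S.1 then r else 1) * (if y ∈ S.1 ∧ x ∉ S.1 then r else 1)) := by
      intro S
      by_cases h : S = S₀
      · subst h
        simp only [f, hS₀.1, hS₀.2, not_true_eq_false, and_false, if_true, if_false, mul_one]
        exact sum_drawWeight_drawn (by omega) p S
      · simp only [f, h, if_false, one_mul]
        by_cases hx : x ∈ S.1 <;> by_cases hy : y ∈ S.1 <;>
          simp only [hx, hy, not_true_eq_false, and_false, false_and, true_and, not_false_eq_true,
            if_true, if_false, mul_one, one_mul]
        · exact sum_drawWeight (by omega) p S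
        · exact sum_drawWeight_negate (by omega) p s S hx
        · exact sum_drawWeight_negate (by omega) p s S hy
        · exact sum_drawWeight (by omega) p S
    rw [hf, expect_prod, Finset.prod_congr rfl fun S _ => hS S, Finset.prod_mul_distrib,
      Finset.prod_mul_distrib, Finset.prod_ite_eq', if_pos (Finset.mem_univ _),
      ← Finset.prod_filter, ← Finset.prod_filter, Finset.prod_const, Finset.prod_const,
      card_dset_mem_notMem (by omega) hxy, card_dset_mem_notMem (by omega) hxy.symm, two_mul,
      pow_add]
  unfold discountedPairs
  simp only [expect_sum]
  refine sum_pairs_le (fun x y hxy => ?_) (by positivity)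
  rw [Finset.sum_congr rfl fun S hS => key x y hxy S (Finset.mem_filter.1 hS).2, Finset.sum_const,
    nsmul_eq_mul]
  refine mul_le_mul_of_nonneg_right ?_ (by positivity)
  exact_mod_cast card_dset_mem_mem_le hd hxy

theorem discountedPairs_term_nonneg {s : ℝ} (h0 : 0 ≤ s) (ω : Sample n d) (x y : Fin n)
    (S : DSet n d) : (0 : ℝ) ≤ (if ω S = none then 0 else 1) *
        (s ^ (ω.negatingWithout x y).card * s ^ (ω.negatingWithout y x).card) := by
  split_ifs <;> positivity

theorem discountedPairs_nonneg {s : ℝ} (h0 : 0 ≤ s) (ω : Sample n d) :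
    0 ≤ ω.discountedPairs s :=
  Finset.sum_nonneg fun _ _ => Finset.sum_nonneg fun _ _ => Finset.sum_nonneg fun _ _ =>
    discountedPairs_term_nonneg h0 _ _ _ _

theorem le_discountedPairs_inner {s : ℝ} (h0 : 0 ≤ s) (h1 : s ≤ 1) {ω : Sample n d} {B : ℕ}
    {x y : Fin n} (hxy : x ≠ y) (hx : (ω.negating x).card ≤ B) (hy : (ω.negating y).card ≤ B)
    (hj : (ω.joint x y).Nonempty) :
    s ^ B * s ^ B ≤ ∑ y ∈ Finset.univ.erase x,
      ∑ S ∈ (Finset.univ : Finset (DSet n d)).filter fun S => x ∈ S.1 ∧ y ∈ S.1,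
        (if ω S = none then 0 else 1) *
          (s ^ (ω.negatingWithout x y).card * s ^ (ω.negatingWithout y x).card) := by
  obtain ⟨S, hS⟩ := hj
  obtain ⟨-, hS, hne⟩ := Finset.mem_filter.1 hS
  have hle : ∀ x y, (ω.negating x).card ≤ B → s ^ B ≤ s ^ (ω.negatingWithout x y).card :=
    fun x y hx => pow_le_pow_of_le_one h0 h1
      ((Finset.card_le_card (ω.negatingWithout_subset x y)).trans hx)
  calc s ^ B * s ^ B ≤ (if ω S = none then 0 else 1) *
        (s ^ (ω.negatingWithout x y).card * s ^ (ω.negatingWithout y x).card) := by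
        rw [if_neg hne, one_mul]
        exact mul_le_mul (hle x y hx) (hle y x hy) (by positivity) (by positivity)
    _ ≤ _ := Finset.single_le_sum (f := fun S => (if ω S = none then 0 else 1) *
        (s ^ (ω.negatingWithout x y).card * s ^ (ω.negatingWithout y x).card))
        (fun S _ => discountedPairs_term_nonneg h0 ω x y S)
        (Finset.mem_filter.2 ⟨Finset.mem_univ S, hS⟩)
    _ ≤ _ := Finset.single_le_sum (f := fun y => ∑ S ∈ (Finset.univ : Finset
        (DSet n d)).filter fun S => x ∈ S.1 ∧ y ∈ S.1, (if ω S = none then 0 else 1) *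
        (s ^ (ω.negatingWithout x y).card * s ^ (ω.negatingWithout y x).card))
        (fun y _ => Finset.sum_nonneg fun S _ => discountedPairs_term_nonneg h0 ω x y S)
        (Finset.mem_erase.2 ⟨hxy.symm, Finset.mem_univ y⟩)

theorem le_discountedPairs {s : ℝ} (h0 : 0 ≤ s) (h1 : s ≤ 1) {ω : Sample n d} {B : ℕ}
    {x y : Fin n} (hxy : x ≠ y) (hx : (ω.negating x).card ≤ B) (hy : (ω.negating y).card ≤ B)
    (hj : (ω.joint x y).Nonempty) : s ^ B * s ^ B ≤ ω.discountedPairs s :=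
  (le_discountedPairs_inner h0 h1 hxy hx hy hj).trans
    (Finset.single_le_sum (f := fun x => ∑ y ∈ Finset.univ.erase x,
      ∑ S ∈ (Finset.univ : Finset (DSet n d)).filter fun S => x ∈ S.1 ∧ y ∈ S.1,
        (if ω S = none then 0 else 1) *
          (s ^ (ω.negatingWithout x y).card * s ^ (ω.negatingWithout y x).card))
      (fun x _ => Finset.sum_nonneg fun y _ => Finset.sum_nonneg fun S _ =>
        discountedPairs_term_nonneg h0 ω x y S) (Finset.mem_univ x))

/-! ### The number of isolated variables -/

/-- The number of variables that are negated alone in no selected clause. -/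
noncomputable def isolatedCount (ω : Sample n d) : ℝ :=
  ∑ x : Fin n, ∏ S : DSet n d, if x ∈ S.1 then (if ω S = some {x} then 0 else 1) else 1

theorem Proper.isolatedCount_eq {ω : Sample n d} (hω : ω.Proper) :
    ω.isolatedCount = (isolated ω.formula).card := by
  have h : ∀ x : Fin n, (∏ S : DSet n d,
      if x ∈ S.1 then (if ω S = some {x} then (0 : ℝ) else 1) else 1) =
      if x ∈ isolated ω.formula then 1 else 0 := by
    intro x
    simp only [hω.mem_isolated, negating]
    split_ifs with h
    · refine Finset.prod_eq_one fun S _ => ?_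
      have h' := Finset.filter_eq_empty_iff.1 h (Finset.mem_univ S)
      split_ifs with h1 h2
      · exact absurd ⟨h1, h2⟩ h'
      · rfl
      · rfl
    · obtain ⟨S, hS⟩ := Finset.nonempty_iff_ne_empty.2 h
      obtain ⟨-, h1, h2⟩ := Finset.mem_filter.1 hS
      exact Finset.prod_eq_zero (Finset.mem_univ S) (by simp [h1, h2])
  simp only [isolatedCount, h]
  simp

/-- Since `0 ^ 0 = 1`, each isolated unsafe `x` contributes at least 1 to the outer sum of
`discountedPairs 0`. -/
theorem Proper.card_isolated_le {ω : Sample n d} (hω : ω.Proper) :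
    ((isolated ω.formula).card : ℝ) ≤ (safe ω.formula).card + ω.discountedPairs 0 := by
  have h1 : (isolated ω.formula).card =
      (safe ω.formula).card + (isolated ω.formula \ safe ω.formula).card := by
    rw [add_comm, Finset.card_sdiff_add_card_eq_card
      (show safe ω.formula ⊆ isolated ω.formula from Finset.filter_subset _ _)]
  have h2 : ((isolated ω.formula \ safe ω.formula).card : ℝ) ≤ ω.discountedPairs 0 := by
    rw [Finset.card_eq_sum_ones, Nat.cast_sum]
    refine (Finset.sum_le_sum fun x hx => ?_).trans (Finset.sum_le_sum_of_subset_of_nonneg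
      (Finset.subset_univ _) fun x _ _ => Finset.sum_nonneg fun y _ =>
        Finset.sum_nonneg fun S _ => discountedPairs_term_nonneg le_rfl ω x y S)
    obtain ⟨hx, hs⟩ := Finset.mem_sdiff.1 hx
    obtain ⟨y, hy, hxy, hj⟩ := exists_joint_of_notMem_safe hx hs
    rw [hω.mem_isolated] at hx hy
    have := le_discountedPairs_inner (s := 0) le_rfl zero_le_one (B := 0) hxy (by simp [hx])
      (by simp [hy]) hj
    simpa using this
  rw [h1, Nat.cast_add]
  linarith

/-- The indicators of isolation are not positively correlated: a set containing both variables gives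
`1 - 2 * q ≤ (1 - q) ^ 2`, and all other sets give equality. The variance is thus at most the
diagonal contribution, the mean. -/
theorem expect_sq_isolatedCount_le (hd : 1 ≤ d) {p : ℝ} (h0 : 0 ≤ p)
    (h1 : p ≤ 1) (hq : p / (2 ^ d - 1) ≤ 1) {μ : ℝ}
    (hμ : μ = n * (1 - p / (2 ^ d - 1)) ^ (n - 1).choose (d - 1)) :
    expect p (fun ω : Sample n d => (ω.isolatedCount - μ) ^ 2) ≤ μ := by
  set q := p / (2 ^ d - 1) with hq'
  set r := (1 - q) ^ (n - 1).choose (d - 1) with hr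
  have hr0 : 0 ≤ r := pow_nonneg (by linarith) _
  let ι : Fin n → Sample n d → ℝ := fun x ω =>
    ∏ S : DSet n d, if x ∈ S.1 then (if ω S = some {x} then 0 else 1) else 1
  have hgood : ∀ x : Fin n, ∏ S : DSet n d, (if x ∈ S.1 then 1 - q else 1) = r := by
    intro x
    rw [← Finset.prod_filter, Finset.prod_const, card_dset_mem hd]
  have hone : ∀ x : Fin n, expect p (ι x) = r := by
    intro x
    rw [← hgood x]
    refine (expect_prod p fun S v => if x ∈ S.1 then (if v = some {x} then 0 else 1) else 1).trans
      (Finset.prod_congr rfl fun S _ => ?_)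
    split_ifs with hx
    · simpa using sum_drawWeight_negate (by omega) p 0 S hx
    · simpa using sum_drawWeight (by omega) p S
  have htwo : ∀ x y : Fin n, expect p (fun ω => ι x ω * ι y ω) ≤ r ^ 2 + if x = y then r else 0 := by
    intro x y
    by_cases hxy : x = y
    · subst hxy
      have h : (fun ω => ι x ω * ι x ω) = ι x := by
        funext ω
        rw [← Finset.prod_mul_distrib]
        refine Finset.prod_congr rfl fun S _ => ?_
        split_ifs <;> norm_num
      rw [h, hone, if_pos rfl]
      nlinarith [sq_nonneg r]
    · rw [if_neg hxy, add_zero, sq]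
      let f : DSet n d → Draw n → ℝ := fun S v =>
        (if x ∈ S.1 then (if v = some {x} then 0 else 1) else 1) *
          (if y ∈ S.1 then (if v = some {y} then 0 else 1) else 1)
      have h : (fun ω => ι x ω * ι y ω) = fun ω : Sample n d => ∏ S : DSet n d, f S (ω S) := by
        funext ω
        exact Finset.prod_mul_distrib.symm
      have hS0 : ∀ S : DSet n d, 0 ≤ ∑ v, drawWeight p S.1 v * f S v := fun S =>
        Finset.sum_nonneg fun v _ => mul_nonneg (drawWeight_nonneg h0 h1 _ _) (mul_nonneg
          (by split_ifs <;> norm_num) (by split_ifs <;> norm_num))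
      have hS : ∀ S : DSet n d, ∑ v, drawWeight p S.1 v * f S v ≤
          (if x ∈ S.1 then 1 - q else 1) * (if y ∈ S.1 then 1 - q else 1) := by
        intro S
        by_cases hx : x ∈ S.1 <;> by_cases hy : y ∈ S.1 <;>
          simp only [f, hx, hy, if_true, if_false, mul_one, one_mul]
        · rw [sum_drawWeight_negate_two (by omega) p S hxy hx hy]
          nlinarith [sq_nonneg q]
        · have := sum_drawWeight_negate (by omega) p 0 S hx
          rw [this, sub_zero, mul_one]
        · have := sum_drawWeight_negate (by omega) p 0 S hy
          rw [this, sub_zero, mul_one]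
        · exact (sum_drawWeight (by omega) p S).le
      calc expect p (fun ω => ι x ω * ι y ω) = ∏ S, ∑ v, drawWeight p S.1 v * f S v := by
            rw [h, expect_prod]
        _ ≤ ∏ S : DSet n d, (if x ∈ S.1 then 1 - q else 1) * (if y ∈ S.1 then 1 - q else 1) :=
            Finset.prod_le_prod (fun S _ => hS0 S) fun S _ => hS S
        _ = r * r := by rw [Finset.prod_mul_distrib, hgood, hgood]
  have hX : ∀ ω : Sample n d, ω.isolatedCount = ∑ x, ι x ω := fun _ => rfl
  have hEX : expect p (isolatedCount : Sample n d → ℝ) = μ := by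
    unfold isolatedCount
    rw [expect_sum, Finset.sum_congr rfl fun x _ => hone x, hμ]
    simp
  have hEX2 : expect p (fun ω : Sample n d => ω.isolatedCount * ω.isolatedCount) ≤ μ ^ 2 + μ := by
    simp only [hX, Finset.sum_mul_sum, expect_sum]
    refine (Finset.sum_le_sum fun x _ => Finset.sum_le_sum fun y _ => htwo x y).trans
      (le_of_eq ?_)
    simp only [Finset.sum_add_distrib, Finset.sum_ite_eq, Finset.mem_univ, if_true,
      Finset.sum_const, Finset.card_univ, Fintype.card_fin, nsmul_eq_mul]
    rw [hμ]
    ring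
  have hone' : expect p (fun _ : Sample n d => (1 : ℝ)) = 1 := by
    have h := expect_prod p fun (_ : DSet n d) (_ : Draw n) => 1
    simpa [sum_drawWeight (show d ≠ 0 by omega)] using h
  have hexp : (fun ω : Sample n d => (ω.isolatedCount - μ) ^ 2) = fun ω =>
      ω.isolatedCount * ω.isolatedCount + (-2 * μ * ω.isolatedCount + μ ^ 2 * 1) := by
    funext ω
    ring
  rw [hexp, expect_add, expect_add, expect_const_mul, expect_const_mul, hEX, hone']
  linarith

end Sample

/-! ### Bounds on the probability that the algorithm fails -/

/-- The samples on which the algorithm fails. -/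
def failing (n d k : ℕ) : Set (Sample n d) :=
  {ω | ¬ (k ≤ (safe ω.formula).card ∨ Refuted ω.formula k)}

/-- By `Proper.decided`, failure needs a triple, counted by `tripleSum`, or two variables of degree
at most `2 * k` in a selected set, which contribute at least `s ^ (4 * k)` to `discountedPairs s`.
-/
theorem sampleLaw_failing_le_of_degrees (hd : 2 ≤ d) {p s : ℝ} (h0 : 0 ≤ p) (h1 : p ≤ 1)
    (hs0 : 0 < s) (hs1 : s ≤ 1) (hr : 0 ≤ 1 - p / (2 ^ d - 1) * (1 - s)) (k : ℕ) :
    sampleLaw n d p (failing n d k) ≤ ENNReal.ofReal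
      ((n : ℝ) ^ 2 * (((n : ℝ) ^ (d - 2)) ^ 3 * p ^ 3) +
        (s ^ (2 * k) * s ^ (2 * k))⁻¹ * ((n : ℝ) ^ 2 * ((n : ℝ) ^ (d - 2) *
          (p * (1 - p / (2 ^ d - 1) * (1 - s)) ^ (2 * (n - 2).choose (d - 1)))))) := by
  have hpos : 0 < s ^ (2 * k) * s ^ (2 * k) := by positivity
  refine (sampleLaw_le_expect h0 h1 (g := fun ω => ω.tripleSum +
    (s ^ (2 * k) * s ^ (2 * k))⁻¹ * ω.discountedPairs s) (fun ω => ?_) fun ω hω hp => ?_).trans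
    (ENNReal.ofReal_le_ofReal ?_)
  · exact add_nonneg ω.tripleSum_nonneg
      (mul_nonneg (inv_nonneg.2 hpos.le) (ω.discountedPairs_nonneg hs0.le))
  · by_contra! hlt
    have hd0 := mul_nonneg (inv_nonneg.2 hpos.le) (ω.discountedPairs_nonneg hs0.le)
    refine hω (hp.decided (fun x y hxy => ?_) fun x y hxy hx hy => ?_)
    · by_contra! h
      linarith [Sample.one_le_tripleSum hxy h]
    · by_contra h
      have := Sample.le_discountedPairs hs0.le hs1 hxy hx hy (Finset.nonempty_iff_ne_empty.2 h)
      have := mul_le_mul_of_nonneg_left this (inv_nonneg.2 hpos.le)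
      rw [inv_mul_cancel₀ hpos.ne'] at this
      linarith [ω.tripleSum_nonneg]
  · rw [expect_add, expect_const_mul]
    exact add_le_add (Sample.expect_tripleSum_le hd h0) (mul_le_mul_of_nonneg_left
      (Sample.expect_discountedPairs_le hd h0 hr) (inv_nonneg.2 hpos.le))

/-- Chebyshev gives more than `μ / 2` isolated variables and Markov fewer than `μ / 4` unsafe ones,
which leaves at least `μ / 4 ≥ k`. -/
theorem sampleLaw_failing_le_of_isolated (hd : 2 ≤ d) {p : ℝ} (h0 : 0 ≤ p) (h1 : p ≤ 1)
    {k : ℕ} (hk : 1 ≤ k) {μ : ℝ} (hμ : μ = n * (1 - p / (2 ^ d - 1)) ^ (n - 1).choose (d - 1))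
    (hkμ : 4 * k ≤ μ) :
    sampleLaw n d p (failing n d k) ≤ ENNReal.ofReal
      (4 / μ + 4 / μ * ((n : ℝ) ^ 2 * ((n : ℝ) ^ (d - 2) *
          (p * (1 - p / (2 ^ d - 1)) ^ (2 * (n - 2).choose (d - 1)))))) := by
  have hk' : (1 : ℝ) ≤ k := by exact_mod_cast hk
  have hμ0 : 0 < μ := by linarith
  have hq : p / (2 ^ d - 1) ≤ 1 := by
    have h2 : (2 : ℝ) ^ 1 ≤ 2 ^ d := pow_le_pow_right₀ (by norm_num) (by omega)
    rw [div_le_one (by linarith)]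
    linarith
  refine (sampleLaw_le_expect h0 h1 (g := fun ω => 4 / μ ^ 2 * (ω.isolatedCount - μ) ^ 2 +
    4 / μ * ω.discountedPairs 0) (fun ω => ?_) fun ω hω hp => ?_).trans
    (ENNReal.ofReal_le_ofReal ?_)
  · have := ω.discountedPairs_nonneg le_rfl
    positivity
  · by_contra! hlt
    refine hω (Or.inl ?_)
    have hD := ω.discountedPairs_nonneg le_rfl
    have a1 : 0 ≤ 4 / μ ^ 2 * (ω.isolatedCount - μ) ^ 2 := by positivity
    have a2 : 0 ≤ 4 / μ * ω.discountedPairs 0 := by positivity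
    have a3 : 4 / μ * ω.discountedPairs 0 < 1 := by linarith
    have a4 : 4 / μ ^ 2 * (ω.isolatedCount - μ) ^ 2 < 1 := by linarith
    have b1 : ω.discountedPairs 0 < μ / 4 := by
      rw [div_mul_eq_mul_div, div_lt_one hμ0] at a3
      linarith
    have b2 : μ / 2 < ω.isolatedCount := by
      rw [div_mul_eq_mul_div, div_lt_one (by positivity)] at a4
      have : |2 * (ω.isolatedCount - μ)| < |μ| := sq_lt_sq.1 (by nlinarith)
      rw [abs_of_pos hμ0] at this
      linarith [(abs_lt.1 this).1]
    rw [hp.isolatedCount_eq] at b2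
    have := hp.card_isolated_le
    have : (k : ℝ) ≤ (safe ω.formula).card := by linarith
    exact_mod_cast this
  · rw [expect_add, expect_const_mul, expect_const_mul]
    refine add_le_add ?_ (mul_le_mul_of_nonneg_left ?_ (by positivity))
    · calc _ ≤ 4 / μ ^ 2 * μ := mul_le_mul_of_nonneg_left
            (Sample.expect_sq_isolatedCount_le (by omega) h0 h1 hq hμ) (by positivity)
        _ = _ := by field_simp
    · simpa using Sample.expect_discountedPairs_le (n := n) (s := 0) hd h0 (by simpa using hq)

end Bounds

end WSat
namespace WSat

/-! ## Asymptotics -/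

section Asymptotics

open Real

theorem tendsto_choose_sub_div_pow (j m : ℕ) :
    Tendsto (fun n : ℕ => ((n - j).choose m : ℝ) / (n : ℝ) ^ m) atTop (𝓝 (1 / m.factorial)) := by
  have h1 : Tendsto (fun n : ℕ => (n.choose m : ℝ) / (n : ℝ) ^ m) atTop (𝓝 (1 / m.factorial)) := by
    have h := isEquivalent_choose m
    have hne : ∀ᶠ n : ℕ in atTop, ((n : ℝ) ^ m / m.factorial) ≠ 0 := by
      filter_upwards [eventually_gt_atTop 0] with n hn
      have : (0 : ℝ) < n := by exact_mod_cast hn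
      positivity
    have h2 := (Asymptotics.isEquivalent_iff_tendsto_one hne).1 h
    have h3 := h2.mul_const (1 / (m.factorial : ℝ))
    rw [one_mul] at h3
    refine h3.congr' ?_
    filter_upwards [eventually_gt_atTop 0] with n hn
    have : (0 : ℝ) < n := by exact_mod_cast hn
    have hf : (0 : ℝ) < m.factorial := by exact_mod_cast m.factorial_pos
    simp only [Pi.div_apply]
    field_simp
  have h2 : Tendsto (fun n : ℕ => (((n - j : ℕ) : ℝ) / n) ^ m) atTop (𝓝 1) := by
    have h : Tendsto (fun n : ℕ => 1 - (j : ℝ) / n) atTop (𝓝 (1 - 0)) :=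
      tendsto_const_nhds.sub (tendsto_const_div_atTop_nhds_zero_nat (j : ℝ))
    rw [sub_zero] at h
    have h' := h.pow m
    rw [one_pow] at h'
    refine h'.congr' ?_
    filter_upwards [eventually_gt_atTop j] with n hn
    have : (0 : ℝ) < n := by exact_mod_cast (by omega : 0 < n)
    rw [Nat.cast_sub hn.le, sub_div, div_self this.ne']
  have h3 := (h1.comp (tendsto_sub_atTop_nat j)).mul h2
  rw [mul_one] at h3
  refine h3.congr' ?_
  filter_upwards [eventually_gt_atTop j] with n hn
  have h0 : (0 : ℝ) < n := by exact_mod_cast (by omega : 0 < n)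
  have h0' : (0 : ℝ) < (n - j : ℕ) := by exact_mod_cast (by omega : 0 < n - j)
  simp only [Function.comp_apply, div_pow]
  field_simp

theorem tendsto_log_pow_div (m : ℕ) :
    Tendsto (fun n : ℕ => log n ^ m / (n : ℝ)) atTop (𝓝 0) :=
  (isLittleO_pow_log_id_atTop (n := m)).tendsto_div_nhds_zero.comp tendsto_natCast_atTop_atTop

theorem tendsto_log_mul_rpow {ε : ℝ} (hε : ε < 0) :
    Tendsto (fun n : ℕ => log n * (n : ℝ) ^ ε) atTop (𝓝 0) := by
  have h := (isLittleO_log_rpow_atTop (neg_pos.2 hε)).tendsto_div_nhds_zero.comp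
    tendsto_natCast_atTop_atTop
  refine h.congr fun n => ?_
  simp only [Function.comp_apply]
  rw [rpow_neg (Nat.cast_nonneg n), div_inv_eq_mul]

/-! ### The threshold for the degree rate -/

variable {d : ℕ} {c : ℝ}

/-- The probability with which a clause is selected. -/
noncomputable def clauseProb (d : ℕ) (c : ℝ) (n : ℕ) : ℝ := c * log n / (n : ℝ) ^ (d - 1)

/-- The limit of the expected number of clauses that a single true variable falsifies, divided by
`log n`. -/
noncomputable def degreeRate (d : ℕ) (c : ℝ) : ℝ := c / (2 ^ d - 1) * (1 / (d - 1).factorial)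

theorem one_lt_two_pow_real (hd : 2 ≤ d) : (1 : ℝ) < 2 ^ d :=
  one_lt_pow₀ (by norm_num) (by omega)

theorem degreeRate_pos (hd : 2 ≤ d) (hc : 0 < c) : 0 < degreeRate d c := by
  have := one_lt_two_pow_real hd
  have hf : (0 : ℝ) < (d - 1).factorial := by exact_mod_cast (d - 1).factorial_pos
  exact mul_pos (div_pos hc (by linarith)) (by positivity)

theorem clauseProb_nonneg (d : ℕ) (hc : 0 < c) (n : ℕ) : 0 ≤ clauseProb d c n :=
  div_nonneg (mul_nonneg hc.le (log_natCast_nonneg n)) (by positivity)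

theorem tendsto_clauseProb (hd : 2 ≤ d) (hc : 0 < c) :
    Tendsto (clauseProb d c) atTop (𝓝 0) := by
  have h := (tendsto_log_pow_div 1).const_mul c
  rw [mul_zero] at h
  refine squeeze_zero' (Eventually.of_forall (clauseProb_nonneg d hc)) ?_ h
  filter_upwards [eventually_ge_atTop 1] with n hn
  have hn' : (1 : ℝ) ≤ n := by exact_mod_cast hn
  have := log_natCast_nonneg n
  rw [clauseProb, pow_one, ← mul_div_assoc]
  refine div_le_div_of_nonneg_left (by positivity) (by linarith) ?_
  calc (n : ℝ) = n ^ 1 := (pow_one _).symm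
    _ ≤ _ := pow_le_pow_right₀ hn' (by omega)

theorem tendsto_clauseProb_mul_choose_div_log (d : ℕ) (c : ℝ) (j : ℕ) :
    Tendsto (fun n : ℕ => clauseProb d c n / (2 ^ d - 1) * (n - j).choose (d - 1) / log n) atTop
      (𝓝 (degreeRate d c)) := by
  refine ((tendsto_choose_sub_div_pow j (d - 1)).const_mul (c / (2 ^ d - 1))).congr' ?_
  filter_upwards [eventually_gt_atTop 1] with n hn
  have : 0 < log n := log_pos (by exact_mod_cast hn)
  rw [clauseProb]
  field_simp

theorem eventually_le_clauseProb_mul_choose (d : ℕ) (c : ℝ) (j : ℕ) {a : ℝ}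
    (ha : a < degreeRate d c) : ∀ᶠ n : ℕ in atTop,
      a * log n ≤ clauseProb d c n / (2 ^ d - 1) * (n - j).choose (d - 1) := by
  filter_upwards [(tendsto_clauseProb_mul_choose_div_log d c j).eventually_const_le ha,
    eventually_gt_atTop 1] with n hn h1
  have : 0 < log n := log_pos (by exact_mod_cast h1)
  rwa [le_div_iff₀ this] at hn

/-- Uses `log (1 - q) ≥ -q / (1 - q)`; as `q → 0`, the denominator is absorbed by the gap between
`degreeRate d c` and `b`. -/
theorem eventually_rpow_neg_le (hd : 2 ≤ d) (hc : 0 < c) (j : ℕ) {b : ℝ}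
    (hb : degreeRate d c < b) : ∀ᶠ n : ℕ in atTop,
      (n : ℝ) ^ (-b) ≤ (1 - clauseProb d c n / (2 ^ d - 1)) ^ (n - j).choose (d - 1) := by
  have hq : Tendsto (fun n => 1 - clauseProb d c n / (2 ^ d - 1)) atTop (𝓝 1) := by
    have h := ((tendsto_clauseProb hd hc).div_const (2 ^ d - 1)).const_sub 1
    simpa using h
  have h := (tendsto_clauseProb_mul_choose_div_log d c j).div hq one_ne_zero
  rw [div_one] at h
  filter_upwards [h.eventually_le_const hb, hq.eventually_const_lt (show (0 : ℝ) < 1 by norm_num),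
    eventually_gt_atTop 1] with n hn hq1 h1
  have hlog : 0 < log n := log_pos (by exact_mod_cast h1)
  have hn0 : (0 : ℝ) < n := by exact_mod_cast (by omega : 0 < n)
  set q := clauseProb d c n / (2 ^ d - 1) with hq_def
  rw [← exp_log hq1, ← exp_nat_mul, rpow_def_of_pos hn0, exp_le_exp]
  have hlq : -(q / (1 - q)) ≤ log (1 - q) := by
    have := one_sub_inv_le_log_of_pos hq1
    have e : 1 - (1 - q)⁻¹ = -(q / (1 - q)) := by
      field_simp
      ring
    rwa [e] at this
  have hm := mul_le_mul_of_nonneg_left hlq (Nat.cast_nonneg (α := ℝ) ((n - j).choose (d - 1)))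
  simp only [Pi.div_apply] at hn
  rw [div_div, div_le_iff₀ (mul_pos hlog hq1)] at hn
  refine le_trans ?_ hm
  have e : ((n - j).choose (d - 1) : ℝ) * -(q / (1 - q)) =
      -((q * (n - j).choose (d - 1)) / (1 - q)) := by ring
  rw [e, mul_neg, neg_le_neg_iff, div_le_iff₀ hq1]
  linarith

theorem one_sub_pow_le_rpow {q a u : ℝ} {n M : ℕ} (hn : 0 < n) (hq : 0 ≤ 1 - q * u) (hu : 0 ≤ u)
    (h : a * log n ≤ q * M) : (1 - q * u) ^ (2 * M) ≤ (n : ℝ) ^ (-(2 * u * a)) := by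
  have hn0 : (0 : ℝ) < n := by exact_mod_cast hn
  calc (1 - q * u) ^ (2 * M) ≤ exp (-(q * u)) ^ (2 * M) :=
        pow_le_pow_left₀ hq (by linarith [add_one_le_exp (-(q * u))]) _
    _ = exp (-(2 * u * (q * M))) := by
        rw [← exp_nat_mul]
        congr 1
        push_cast
        ring
    _ ≤ exp (-(2 * u * (a * log n))) := by
        refine exp_le_exp.2 (neg_le_neg (mul_le_mul_of_nonneg_left h (by positivity)))
    _ = _ := by
        rw [rpow_def_of_pos hn0]
        congr 1
        ring

theorem sq_mul_pow_mul_clauseProb (hd : 2 ≤ d) (c : ℝ) {n : ℕ} (hn : 0 < n) (z : ℝ) :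
    (n : ℝ) ^ 2 * ((n : ℝ) ^ (d - 2) * (clauseProb d c n * z)) = c * (log n * (n * z)) := by
  have hn0 : (0 : ℝ) < n := by exact_mod_cast hn
  obtain ⟨m, rfl⟩ := Nat.exists_eq_add_of_le' hd
  simp only [clauseProb, Nat.add_sub_cancel, show m + 2 - 1 = m + 1 by omega]
  field_simp
  ring

theorem sq_mul_pow_mul_clauseProb_cube (hd : 2 ≤ d) (c : ℝ) {n : ℕ} (hn : 0 < n) :
    (n : ℝ) ^ 2 * (((n : ℝ) ^ (d - 2)) ^ 3 * clauseProb d c n ^ 3) = c ^ 3 * (log n ^ 3 / n) := by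
  have hn0 : (0 : ℝ) < n := by exact_mod_cast hn
  obtain ⟨m, rfl⟩ := Nat.exists_eq_add_of_le' hd
  simp only [clauseProb, Nat.add_sub_cancel, show m + 2 - 1 = m + 1 by omega]
  field_simp
  ring

theorem tendsto_sampleLaw_failing_of_lt (hd : 2 ≤ d) (hc : 0 < c) (hrate : 1 / 2 < degreeRate d c)
    (k : ℕ) : Tendsto (fun n => sampleLaw n d (clauseProb d c n) (failing n d k)) atTop (𝓝 0) := by
  obtain ⟨a, ha, ha'⟩ := exists_between hrate
  have h2 := one_lt_two_pow_real hd
  -- Chosen so that `1 - 2 * (1 - s) * a = 1 / 2 - a < 0`. It is positive because `a > 1 / 2`, as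
  -- the division by powers of `s` requires.
  set s := 1 / 2 - 1 / (4 * a) with hs
  have ha0 : 0 < a := by linarith
  have hs0 : 0 < s := by
    rw [hs, sub_pos, div_lt_div_iff₀ (by positivity) (by norm_num)]
    linarith
  have hs1 : s ≤ 1 := by
    have : 0 < 1 / (4 * a) := by positivity
    linarith
  have hsa : 1 + -(2 * (1 - s) * a) = 1 / 2 - a := by
    rw [hs]
    field_simp
    ring
  set K := (s ^ (2 * k) * s ^ (2 * k))⁻¹ with hK
  have hK0 : 0 ≤ K := by positivity
  have hlim : Tendsto (fun n : ℕ => c ^ 3 * (log n ^ 3 / n) +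
      K * (c * (log n * (n : ℝ) ^ (1 / 2 - a)))) atTop (𝓝 0) := by
    have h := ((tendsto_log_pow_div 3).const_mul (c ^ 3)).add
      (((tendsto_log_mul_rpow (ε := 1 / 2 - a) (by linarith)).const_mul c).const_mul K)
    simpa using h
  have hlim' := ENNReal.tendsto_ofReal hlim
  rw [ENNReal.ofReal_zero] at hlim'
  refine tendsto_of_tendsto_of_tendsto_of_le_of_le' tendsto_const_nhds hlim'
    (Eventually.of_forall fun _ => zero_le) ?_
  filter_upwards [(tendsto_clauseProb hd hc).eventually_le_const (show (0 : ℝ) < 1 by norm_num),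
    eventually_le_clauseProb_mul_choose d c 2 ha', eventually_gt_atTop 0] with n hp1 hM hn
  have hp0 := clauseProb_nonneg d hc n
  have hn0 : (0 : ℝ) < n := by exact_mod_cast hn
  have hq1 : clauseProb d c n / (2 ^ d - 1) ≤ 1 := by
    have : (2 : ℝ) ^ 1 ≤ 2 ^ d := pow_le_pow_right₀ (by norm_num) (by omega)
    rw [div_le_one (by linarith)]
    linarith
  have hq0 : 0 ≤ clauseProb d c n / (2 ^ d - 1) := div_nonneg hp0 (by linarith)
  have hr : 0 ≤ 1 - clauseProb d c n / (2 ^ d - 1) * (1 - s) := by nlinarith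
  refine (sampleLaw_failing_le_of_degrees hd hp0 hp1 hs0 hs1 hr k).trans
    (ENNReal.ofReal_le_ofReal ?_)
  rw [sq_mul_pow_mul_clauseProb_cube hd c hn, sq_mul_pow_mul_clauseProb hd c hn]
  have hz := one_sub_pow_le_rpow hn hr (by linarith) hM
  have hnz : (n : ℝ) * (1 - clauseProb d c n / (2 ^ d - 1) * (1 - s)) ^
      (2 * (n - 2).choose (d - 1)) ≤ (n : ℝ) ^ (1 / 2 - a) := by
    rw [← hsa, rpow_add hn0, rpow_one]
    exact mul_le_mul_of_nonneg_left hz hn0.le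
  gcongr

theorem tendsto_sampleLaw_failing_of_le (hd : 2 ≤ d) (hc : 0 < c) (hrate : degreeRate d c ≤ 1 / 2)
    {k : ℕ} (hk : 1 ≤ k) :
    Tendsto (fun n => sampleLaw n d (clauseProb d c n) (failing n d k)) atTop (𝓝 0) := by
  have hr0 := degreeRate_pos hd hc
  have h2 := one_lt_two_pow_real hd
  -- With these factors `b ≤ 5 / 8 < 1`, so `μ` grows, and `b - 2 * a = -degreeRate d c / 4 < 0`, so
  -- unsafe variables are negligible against `μ`.
  set a := 3 / 4 * degreeRate d c with ha
  set b := 5 / 4 * degreeRate d c with hb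
  have hlim : Tendsto (fun n : ℕ => 4 * (n : ℝ) ^ (-(1 - b)) +
      4 * (c * (log n * (n : ℝ) ^ (b - 2 * a)))) atTop (𝓝 0) := by
    have h1 := (tendsto_rpow_neg_atTop (show 0 < 1 - b by linarith)).comp
      tendsto_natCast_atTop_atTop
    have h := (h1.const_mul 4).add
      (((tendsto_log_mul_rpow (ε := b - 2 * a) (by linarith)).const_mul c).const_mul 4)
    simpa using h
  have hlim' := ENNReal.tendsto_ofReal hlim
  rw [ENNReal.ofReal_zero] at hlim'
  refine tendsto_of_tendsto_of_tendsto_of_le_of_le' tendsto_const_nhds hlim'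
    (Eventually.of_forall fun _ => zero_le) ?_
  have hbig := (tendsto_rpow_atTop (show 0 < 1 - b by linarith)).comp
    tendsto_natCast_atTop_atTop
  filter_upwards [(tendsto_clauseProb hd hc).eventually_le_const (show (0 : ℝ) < 1 by norm_num),
    eventually_le_clauseProb_mul_choose d c 2 (show a < degreeRate d c by linarith),
    eventually_rpow_neg_le hd hc 1 (show degreeRate d c < b by linarith),
    hbig.eventually_ge_atTop (4 * k : ℝ), eventually_gt_atTop 0] with n hp1 hM hI hkn hn
  simp only [Function.comp_apply] at hkn
  have hp0 := clauseProb_nonneg d hc n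
  have hn0 : (0 : ℝ) < n := by exact_mod_cast hn
  have hq1 : clauseProb d c n / (2 ^ d - 1) ≤ 1 := by
    have : (2 : ℝ) ^ 1 ≤ 2 ^ d := pow_le_pow_right₀ (by norm_num) (by omega)
    rw [div_le_one (by linarith)]
    linarith
  set μ := n * (1 - clauseProb d c n / (2 ^ d - 1)) ^ (n - 1).choose (d - 1) with hμ
  have hμn : (n : ℝ) ^ (1 - b) ≤ μ := by
    rw [sub_eq_add_neg, rpow_add hn0, rpow_one]
    exact mul_le_mul_of_nonneg_left hI hn0.le
  have hnb : 0 < (n : ℝ) ^ (1 - b) := rpow_pos_of_pos hn0 _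
  have h4 : 4 / μ ≤ 4 * (n : ℝ) ^ (-(1 - b)) := by
    rw [rpow_neg hn0.le, ← div_eq_mul_inv]
    exact div_le_div_of_nonneg_left (by norm_num) hnb hμn
  refine (sampleLaw_failing_le_of_isolated hd hp0 hp1 hk hμ (hkn.trans hμn)).trans
    (ENNReal.ofReal_le_ofReal ?_)
  rw [sq_mul_pow_mul_clauseProb hd c hn]
  have hz := one_sub_pow_le_rpow (u := 1) hn (by simpa using hq1) zero_le_one hM
  rw [mul_one, mul_one] at hz
  have hlog := log_natCast_nonneg n
  refine add_le_add h4 ?_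
  calc 4 / μ * (c * (log n * (n * (1 - clauseProb d c n / (2 ^ d - 1)) ^
        (2 * (n - 2).choose (d - 1)))))
      ≤ 4 * (n : ℝ) ^ (-(1 - b)) * (c * (log n * (n * (n : ℝ) ^ (-(2 * a))))) := by
        gcongr
    _ = 4 * (c * (log n * ((n : ℝ) ^ (-(1 - b)) * ((n : ℝ) ^ (1 : ℝ) * (n : ℝ) ^ (-(2 * a)))))) := by
        rw [rpow_one]
        ring
    _ = _ := by
        rw [← rpow_add hn0, ← rpow_add hn0]
        ring_nf

theorem tendsto_sampleLaw_failing (hd : 2 ≤ d) (hc : 0 < c) {k : ℕ} (hk : 1 ≤ k) :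
    Tendsto (fun n => sampleLaw n d (clauseProb d c n) (failing n d k)) atTop (𝓝 0) := by
  rcases lt_or_ge (1 / 2) (degreeRate d c) with h | h
  · exact tendsto_sampleLaw_failing_of_lt hd hc h k
  · exact tendsto_sampleLaw_failing_of_le hd hc h hk

theorem isProbabilityMeasure_sampleLaw (n : ℕ) (hd : d ≠ 0) {p : ℝ} (h0 : 0 ≤ p) (h1 : p ≤ 1) :
    IsProbabilityMeasure (sampleLaw n d p) := by
  refine ⟨?_⟩
  rw [sampleLaw, Measure.pi_univ]
  refine Finset.prod_eq_one fun S _ => ?_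
  rw [← Finset.coe_univ, ← sum_measure_singleton, Finset.sum_congr rfl fun v _ =>
    drawLaw_singleton p S.1 v, ← ENNReal.ofReal_sum_of_nonneg fun v _ =>
    drawWeight_nonneg h0 h1 S.1 v, sum_drawWeight hd, ENNReal.ofReal_one]

end Asymptotics

end WSat

theorem theorem1 (d : ℕ) (hd : 2 ≤ d) :
    ∃ (P : Program) (A e : ℕ),
      (∀ (n k : ℕ), 1 ≤ n → 1 ≤ k → ∀ (F : Formula n), IsDCNF d F →
        ∀ (L : List (List (Lit n))), IsListing L F →
          ∃ (t : ℕ) (M : Memory), Exec P (input L k) t M ∧ t ≤ A * (k ^ 2 * n + n ^ e) ∧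
            (Answers F k M ∨ Fails M)) ∧
      (∀ (k : ℕ), 1 ≤ k → ∀ (c : ℝ), 0 < c →
        Tendsto (fun n : ℕ =>
          sampleLaw n d (c * Real.log n / (n : ℝ) ^ (d - 1))
            {ω | ∀ (L : List (List (Lit n))), IsListing L ω.formula →
              ∃ (t : ℕ) (M : Memory), Exec P (input L k) t M ∧ Answers ω.formula k M})
          atTop (𝓝 1)) := by
  obtain ⟨A, e, h⟩ := exists_solver_time_le d
  refine ⟨solver d, A, e, fun n k hn hk F hF L hL => ?_, fun k hk c hc => ?_⟩
  · obtain ⟨M, ⟨t, ht, hM⟩, hv, ho⟩ := h n k hn F hF L hL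
    exact ⟨t, M, hM, ht.trans (Nat.mul_le_mul_left _ (by omega)), (answers_or_fails hk hv ho).2⟩
  · have hlim := ENNReal.Tendsto.sub (tendsto_const_nhds (x := (1 : ℝ≥0∞)))
      (tendsto_sampleLaw_failing hd hc hk) (Or.inl ENNReal.one_ne_top)
    rw [tsub_zero] at hlim
    have hp := (tendsto_clauseProb hd hc).eventually_le_const (show (0 : ℝ) < 1 by norm_num)
    refine tendsto_of_tendsto_of_tendsto_of_le_of_le' hlim tendsto_const_nhds ?_ ?_
    · filter_upwards [hp, eventually_ge_atTop 1] with n hp1 hn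
      have := isProbabilityMeasure_sampleLaw n (show d ≠ 0 by omega) (clauseProb_nonneg d hc n) hp1
      -- Success and `failing` cover the space, so subadditivity gives the lower bound.
      rw [tsub_le_iff_right, ← measure_univ (μ := sampleLaw n d (clauseProb d c n))]
      refine (measure_mono fun ω _ => ?_).trans (measure_union_le _ _)
      by_cases hω : ω ∈ failing n d k
      · exact Or.inr hω
      · refine Or.inl fun L hL => ?_
        obtain ⟨M, ⟨t, ht, hM⟩, hv, ho⟩ := h n k hn _ ω.isDCNF_formula L hL
        exact ⟨t, M, hM, (answers_or_fails hk hv ho).1 (not_not.1 hω)⟩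
    · filter_upwards [hp] with n hp1
      have := isProbabilityMeasure_sampleLaw n (show d ≠ 0 by omega) (clauseProb_nonneg d hc n) hp1
      exact prob_le_one (μ := sampleLaw n d (clauseProb d c n))
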